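/- Let $M$ be a compact connected complex manifold (Hausdorff, without boundary) of complex dimension at least $2$, with a locally conformally Kähler (lcK) structure $(\omega,\theta)$: $\omega$ is the $(1,1)$-form of a smooth Hermitian metric, the Lee form $\theta$ is a smooth closed $1$-form, and $d\omega=\theta\wedge\omega$. Let $\lambda\in\mathbb C\setminus\{0\}$ with $|\lambda|\neq 1$, let $H^\infty_\lambda=(\ell^2(\mathbb C)\setminus\{0\})/\langle\lambda\cdot\mathrm{id}\rangle$ be the infinite-dimensional classical Hopf manifold, with the form $\omega_H=\|z\|^{-2}\omega_0$, where $\omega_0=dd^c\|z\|^2$ is the form of the flat metric and $dd^c=\frac{\sqrt{-1}}2\partial\bar\partial$, and let $F\colon M\to H^\infty_\lambda$ be a global lcK immersion, i.e. a holomorphic map with $F^*\omega_H=\omega$. A Kähler covering of $M$ is a connected holomorphic Galois covering $\pi\colon\tilde M\to M$ with a smooth function $h$ on $\tilde M$ such that $\pi^*\theta=dh$; its Kähler form is $\tilde\omega=e^{-h}\pi^*\omega$. Its homothety character is the homomorphism $\chi$ from the deck transformation group $\Gamma$ to $\mathbb R^{>0}$ given by $\gamma^*\tilde\omega=\chi(\gamma)\tilde\omega$;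 the covering is minimal if $\chi$ is injective. The lcK rank is the rank of the abelian group $\mathrm{im}\,\chi$. A positive automorphic potential is a smooth function $\psi>0$ on $\tilde M$ with $dd^c\psi=\tilde\omega$ and $\gamma^*\psi=\chi(\gamma)\psi$ for all $\gamma\in\Gamma$; it is proper if $\psi\colon\tilde M\to(0,\infty)$ is a proper map. The homothety character of $H^\infty_\lambda$ is $\chi_0\colon\mathbb Z\to\mathbb R^{>0}$, $\chi_0(k)=|\lambda|^{2k}$, so that $(\lambda^k\cdot\mathrm{id})^*\omega_0=\chi_0(k)\,\omega_0$. Then $(M,\omega)$ admits a proper positive automorphic potential, induced by $F$. More precisely: 1. There are a minimal Kähler covering $\tilde M$ of $M$ and a holomorphic lift $\tilde F\colon\tilde M\to\ell^2(\mathbb C)\setminus\{0\}$ of $F$ such that $\psi=\|\tilde F\|^2$ is a positive automorphic potential of $\tilde\omega$ and is proper; its homothety character $\chi$ satisfies $\mathrm{im}\,\chi\subseteq\mathrm{im}\,\chi_0$, and the lcK rank is $1$. 2. For every Kähler covering $(\pi\colon\tilde M\to M,h)$, the homothety character $\chi$ exists, $\mathrm{im}\,\chi\subseteq\mathrm{im}\,\chi_0$,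 and the lcK rank is $1$. Moreover $F$ has a holomorphic lift $\tilde F\colon\tilde M\to\ell^2(\mathbb C)\setminus\{0\}$ for which $\pi^*\omega=\|\tilde F\|^{-2}dd^c\|\tilde F\|^2$, and there is a constant $c>0$ such that $c\,\|\tilde F\|^2$ is a positive automorphic potential of $\tilde\omega$; this potential is proper if the covering is minimal. -/

import Mathlib

open scoped Manifold ContDiff Topology

universe u v w

noncomputable section

/-! ### Differential forms on manifolds modelled on a complex normed space -/

section Forms

variable {E : Type*} [NormedAddCommGroup E] [NormedSpace ℂ E]
  {M : Type*} [TopologicalSpace M] [ChartedSpace E M]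
  {E' : Type*} [NormedAddCommGroup E'] [NormedSpace ℂ E']
  {N : Type*} [TopologicalSpace N] [ChartedSpace E' N]

/-- Real differential `k`-forms on `M` (no smoothness required). The real tangent space
`TangentSpace 𝓘(ℝ, E) x` is by definition `E`, a tangent vector being represented in the
preferred chart `chartAt E x`. As the charts of a complex manifold are holomorphic, the complex
structure `J` of the tangent space is multiplication by `Complex.I`. -/
abbrev DiffForm (E : Type*) [NormedAddCommGroup E] [NormedSpace ℂ E] (M : Type*) (k : ℕ) :
    Type _ :=
  M → E [⋀^Fin k]→L[ℝ] ℝ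

/-- The pullback `f^* Ω` of a differential form by a (real differentiable) map. -/
def DiffForm.pullback {k : ℕ} (f : N → M) (Ω : DiffForm E M k) : DiffForm E' N k :=
  fun y => (Ω (f y)).compContinuousLinearMap
    (mfderiv 𝓘(ℝ, E') 𝓘(ℝ, E) f y : E' →L[ℝ] E)

/-- A form is smooth if it has smooth coefficients in all charts. -/
def DiffForm.Smooth {k : ℕ} (Ω : DiffForm E M k) : Prop :=
  ∀ e ∈ atlas E M, ContDiffOn ℝ ∞ (DiffForm.pullback (E' := E) (e.symm : E → M) Ω) e.target

/-- The exterior derivative, computed at `x` in the preferred chart at `x`. -/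
def DiffForm.d {k : ℕ} (Ω : DiffForm E M k) : DiffForm E M (k + 1) :=
  fun x => extDeriv (DiffForm.pullback (E' := E) ((chartAt E x).symm : E → M) Ω) (chartAt E x x)

/-- The differential of a real function, as a `1`-form. -/
def differential (E : Type*) [NormedAddCommGroup E] [NormedSpace ℂ E] {M : Type*}
    [TopologicalSpace M] [ChartedSpace E M] (f : M → ℝ) : DiffForm E M 1 :=
  fun x => ContinuousAlternatingMap.ofSubsingleton ℝ E ℝ (0 : Fin 1)
    (mfderiv 𝓘(ℝ, E) 𝓘(ℝ, ℝ) f x : E →L[ℝ] ℝ)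

/-- The complex structure on tangent vectors. -/
def complexStructure (E : Type*) [NormedAddCommGroup E] [NormedSpace ℂ E] : E →L[ℝ] E :=
  (Complex.I • ContinuousLinearMap.id ℂ E).restrictScalars ℝ

/-- The operator `d^c = (√-1/4) (∂̄ - ∂)`, i.e. `d^c f (v) = - df (J v) / 4`. It is normalised so
that `d d^c = (√-1/2) ∂ ∂̄`. -/
def dc (E : Type*) [NormedAddCommGroup E] [NormedSpace ℂ E] {M : Type*}
    [TopologicalSpace M] [ChartedSpace E M] (f : M → ℝ) : DiffForm E M 1 :=
  fun x => (-(1 / 4 : ℝ)) • (differential E f x).compContinuousLinearMap (complexStructure E)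

/-- The real `(1,1)`-form `d d^c f = (√-1/2) ∂ ∂̄ f`. -/
def ddc (E : Type*) [NormedAddCommGroup E] [NormedSpace ℂ E] {M : Type*}
    [TopologicalSpace M] [ChartedSpace E M] (f : M → ℝ) : DiffForm E M 2 :=
  (dc E f).d

/-- `(Ω, θ)` is a locally conformally Kähler structure on the complex manifold `M`: `Ω` is the
`(1,1)`-form of a Hermitian metric `g` (`Ω(v, w) = g(Jv, w)`, so `g(v, w) = Ω(v, Jw)`), `θ` is a
closed `1`-form, the Lee form, and `dΩ = θ ∧ Ω`. -/
structure IsLCK (Ω : DiffForm E M 2) (θ : DiffForm E M 1) : Prop where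
  smooth_form : Ω.Smooth
  smooth_lee : θ.Smooth
  type_one_one : ∀ (x : M) (v w : E), Ω x ![Complex.I • v, Complex.I • w] = Ω x ![v, w]
  pos : ∀ (x : M) (v : E), v ≠ 0 → 0 < Ω x ![v, Complex.I • v]
  lee_closed : θ.d = 0
  d_form : ∀ (x : M) (v₀ v₁ v₂ : E), Ω.d x ![v₀, v₁, v₂] =
    θ x ![v₀] * Ω x ![v₁, v₂] - θ x ![v₁] * Ω x ![v₀, v₂] + θ x ![v₂] * Ω x ![v₀, v₁]

end Forms

/-! ### Classical Hopf manifolds of finite or infinite dimension -/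

/-- The complex numbers `l ≠ 0` with `|l| ≠ 1`. -/
structure HopfParameter where
  val : ℂ
  ne_zero : val ≠ 0
  norm_ne_one : ‖val‖ ≠ 1

section Hopf

variable (V : Type*) [NormedAddCommGroup V] [InnerProductSpace ℂ V] (l : HopfParameter)

/-- The orbit relation on `V \ {0}` of the group generated by `l • id`. -/
def hopfSetoid : Setoid {z : V // z ≠ 0} where
  r z z' := ∃ k : ℤ, (z' : V) = l.val ^ k • (z : V)
  iseqv :=
    { refl := fun z => ⟨0, by simp⟩
      symm := by
        rintro z z' ⟨k, hk⟩
        refine ⟨-k, ?_⟩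
        rw [hk, smul_smul, ← zpow_add₀ l.ne_zero]
        simp
      trans := by
        rintro z z' z'' ⟨k, hk⟩ ⟨m, hm⟩
        refine ⟨m + k, ?_⟩
        rw [hm, hk, smul_smul, ← zpow_add₀ l.ne_zero] }

/-- The classical Hopf manifold `(V \ {0}) / ⟨l • id⟩`. -/
def HopfManifold : Type _ := Quotient (hopfSetoid V l)

/-- The Hopf manifold carries the quotient topology. -/
instance : TopologicalSpace (HopfManifold V l) :=
  inferInstanceAs (TopologicalSpace (Quotient (hopfSetoid V l)))

variable {V}

/-- The quotient map `V \ {0} → (V \ {0}) / ⟨l • id⟩`. -/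
def hopfMk (z : {z : V // z ≠ 0}) : HopfManifold V l := Quotient.mk (hopfSetoid V l) z

variable {l}

/-- `z` is a nonzero vector representing the point `p` of the Hopf manifold. -/
def IsHopfLift (z : V) (p : HopfManifold V l) : Prop := ∃ hz : z ≠ 0, hopfMk l ⟨z, hz⟩ = p

/-- A chart of the Hopf manifold which is a local section of the quotient map. -/
def IsHopfChart (e : OpenPartialHomeomorph (HopfManifold V l) V) : Prop :=
  ∀ p ∈ e.source, IsHopfLift (e p) p

theorem hopfMk_eq_iff (z z' : {z : V // z ≠ 0}) :
    hopfMk l z = hopfMk l z' ↔ ∃ k : ℤ, (z' : V) = l.val ^ k • (z : V) := by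
  unfold hopfMk
  exact Quotient.eq (r := hopfSetoid V l)

theorem continuous_hopfMk : Continuous (hopfMk l : {z : V // z ≠ 0} → HopfManifold V l) :=
  continuous_quot_mk

theorem isOpenMap_hopfMk : IsOpenMap (hopfMk l : {z : V // z ≠ 0} → HopfManifold V l) := by
  intro U hU
  change IsOpen (hopfMk l ⁻¹' (hopfMk l '' U))
  have h : hopfMk l ⁻¹' (hopfMk l '' U) = ⋃ k : ℤ,
      (fun z : {z : V // z ≠ 0} => (⟨l.val ^ k • (z : V),
        smul_ne_zero (zpow_ne_zero _ l.ne_zero) z.2⟩ : {z : V // z ≠ 0})) ⁻¹' U := by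
    ext z
    simp only [Set.mem_preimage, Set.mem_image, Set.mem_iUnion]
    constructor
    · rintro ⟨y, hy, hyz⟩
      obtain ⟨k, hk⟩ := (hopfMk_eq_iff z y).1 hyz.symm
      refine ⟨k, ?_⟩
      have : (⟨l.val ^ k • (z : V), smul_ne_zero (zpow_ne_zero _ l.ne_zero) z.2⟩ :
        {z : V // z ≠ 0}) = y := Subtype.ext hk.symm
      rwa [this]
    · rintro ⟨k, hk⟩
      exact ⟨_, hk, ((hopfMk_eq_iff z _).2 ⟨k, rfl⟩).symm⟩
  rw [h]
  refine isOpen_iUnion fun k => hU.preimage ?_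
  exact Continuous.subtype_mk (continuous_const.smul continuous_subtype_val) _

/-- A number `c > 1` such that `|l| ^ k` is within `(c⁻², c²)` only for `k = 0`. -/
theorem exists_hopf_gap (l : HopfParameter) :
    ∃ c : ℝ, 1 < c ∧ ∀ k : ℤ, (c ^ 2)⁻¹ < ‖l.val‖ ^ k → ‖l.val‖ ^ k < c ^ 2 → k = 0 := by
  have hpos : 0 < ‖l.val‖ := norm_pos_iff.2 l.ne_zero
  have key : ∀ r : ℝ, 1 < r → ∃ c : ℝ, 1 < c ∧
      ∀ k : ℤ, (c ^ 2)⁻¹ < r ^ k → r ^ k < c ^ 2 → k = 0 := by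
    intro r hr
    refine ⟨Real.sqrt r, by rw [Real.lt_sqrt (by norm_num)]; simpa using hr, ?_⟩
    intro k h1 h2
    rw [Real.sq_sqrt (by linarith)] at h1 h2
    have h1' : r ^ (-1 : ℤ) < r ^ k := by simpa using h1
    have h2' : r ^ k < r ^ (1 : ℤ) := by simpa using h2
    have := (zpow_lt_zpow_iff_right₀ hr).1 h1'
    have := (zpow_lt_zpow_iff_right₀ hr).1 h2'
    omega
  rcases lt_or_gt_of_ne l.norm_ne_one with h | h
  · obtain ⟨c, hc, hk⟩ := key ‖l.val‖⁻¹ ((one_lt_inv₀ hpos).2 h)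
    refine ⟨c, hc, fun k h1 h2 => ?_⟩
    have := hk (-k) (by simpa using h1) (by simpa using h2)
    omega
  · exact key _ h

/-- Every point of the Hopf manifold lies in the domain of a local section of the quotient map. -/
theorem exists_hopfChart (p : HopfManifold V l) :
    ∃ e : OpenPartialHomeomorph (HopfManifold V l) V, p ∈ e.source ∧ IsHopfChart e := by
  obtain ⟨z, rfl⟩ : ∃ z, hopfMk l z = p := Quotient.exists_rep p
  obtain ⟨c, hc, hgap⟩ := exists_hopf_gap l
  have hzpos : 0 < ‖(z : V)‖ := norm_pos_iff.2 z.2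
  have hc0 : 0 < c := by linarith
  let U : Set V := {y | c⁻¹ * ‖(z : V)‖ < ‖y‖ ∧ ‖y‖ < c * ‖(z : V)‖}
  have hU : IsOpen U :=
    (isOpen_lt continuous_const continuous_norm).inter
      (isOpen_lt continuous_norm continuous_const)
  have hzU : (z : V) ∈ U := by
    refine ⟨?_, ?_⟩
    · have : c⁻¹ < 1 := inv_lt_one_of_one_lt₀ hc
      nlinarith
    · nlinarith
  have hne : ∀ y ∈ U, y ≠ 0 := by
    rintro y hy rfl
    have h1 := hy.1
    rw [norm_zero] at h1
    have : 0 < c⁻¹ * ‖(z : V)‖ := by positivity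
    linarith
  have : Nonempty U := ⟨⟨z, hzU⟩⟩
  let i : U → {y : V // y ≠ 0} := fun y => ⟨y, hne y y.2⟩
  have hi : Topology.IsOpenEmbedding i := by
    refine Topology.IsOpenEmbedding.of_comp i
      (IsOpen.isOpenEmbedding_subtypeVal (isOpen_compl_singleton (x := (0 : V)))) ?_
    exact hU.isOpenEmbedding_subtypeVal
  let j : U → HopfManifold V l := fun y => hopfMk l (i y)
  have hj : Topology.IsOpenEmbedding j := by
    refine Topology.IsOpenEmbedding.of_continuous_injective_isOpenMap
      (continuous_hopfMk.comp hi.continuous) ?_ (isOpenMap_hopfMk.comp hi.isOpenMap)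
    intro y y' hyy
    obtain ⟨k, hk⟩ := (hopfMk_eq_iff (i y) (i y')).1 hyy
    have hk' : (y' : V) = l.val ^ k • (y : V) := hk
    have hn : ‖(y' : V)‖ = ‖l.val‖ ^ k * ‖(y : V)‖ := by rw [hk', norm_smul, norm_zpow]
    have hy1 := y.2.1
    have hy2 := y.2.2
    have hy1' := y'.2.1
    have hy2' := y'.2.2
    have hypos : 0 < ‖(y : V)‖ := norm_pos_iff.2 (hne y y.2)
    have hcc : c * c⁻¹ = 1 := mul_inv_cancel₀ hc0.ne'
    have hci : 0 < c⁻¹ := inv_pos.2 hc0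
    have hz1 : ‖(z : V)‖ < c * ‖(y : V)‖ := by
      have := mul_lt_mul_of_pos_left hy1 hc0
      rwa [← mul_assoc, hcc, one_mul] at this
    have hz2 : c⁻¹ * ‖(y : V)‖ < ‖(z : V)‖ := by
      have := mul_lt_mul_of_pos_left hy2 hci
      rwa [← mul_assoc, mul_comm c⁻¹ c, hcc, one_mul] at this
    have hk0 : k = 0 := by
      refine hgap k ?_ ?_
      · have h : (c ^ 2)⁻¹ * ‖(y : V)‖ < ‖l.val‖ ^ k * ‖(y : V)‖ := by
          rw [← hn]
          calc (c ^ 2)⁻¹ * ‖(y : V)‖ = c⁻¹ * (c⁻¹ * ‖(y : V)‖) := by rw [sq, mul_inv, mul_assoc]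
            _ < c⁻¹ * ‖(z : V)‖ := mul_lt_mul_of_pos_left hz2 hci
            _ < ‖(y' : V)‖ := hy1'
        exact lt_of_mul_lt_mul_right h hypos.le
      · have h : ‖l.val‖ ^ k * ‖(y : V)‖ < c ^ 2 * ‖(y : V)‖ := by
          rw [← hn]
          calc ‖(y' : V)‖ < c * ‖(z : V)‖ := hy2'
            _ < c * (c * ‖(y : V)‖) := mul_lt_mul_of_pos_left hz1 hc0
            _ = c ^ 2 * ‖(y : V)‖ := by ring
        exact lt_of_mul_lt_mul_right h hypos.le
    apply Subtype.ext
    rw [hk', hk0]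
    simp
  let e₁ := hj.toOpenPartialHomeomorph j
  let e₂ := hU.isOpenEmbedding_subtypeVal.toOpenPartialHomeomorph (Subtype.val : U → V)
  refine ⟨e₁.symm.trans e₂, ?_, ?_⟩
  · simp only [OpenPartialHomeomorph.trans_source, OpenPartialHomeomorph.symm_source, e₁, e₂,
      Topology.IsOpenEmbedding.toOpenPartialHomeomorph_target,
      Topology.IsOpenEmbedding.toOpenPartialHomeomorph_source, Set.preimage_univ, Set.inter_univ]
    exact ⟨⟨z, hzU⟩, rfl⟩
  · intro q hq
    simp only [OpenPartialHomeomorph.trans_source, OpenPartialHomeomorph.symm_source, e₁, e₂,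
      Topology.IsOpenEmbedding.toOpenPartialHomeomorph_target,
      Topology.IsOpenEmbedding.toOpenPartialHomeomorph_source, Set.preimage_univ,
      Set.inter_univ] at hq
    obtain ⟨y, rfl⟩ := hq
    have hy : (e₁.symm.trans e₂) (j y) = (y : V) := by
      have : e₁.symm (j y) = y := hj.toOpenPartialHomeomorph_left_inv j
      rw [OpenPartialHomeomorph.coe_trans, Function.comp_apply, this]
      rfl
    rw [hy]
    exact ⟨hne y y.2, rfl⟩

/-- The Hopf manifold as a manifold modelled on `V`: the charts are all the local sections of the
quotient map `V \ {0} → (V \ {0}) / ⟨l • id⟩`. -/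
instance : ChartedSpace V (HopfManifold V l) where
  atlas := {e | IsHopfChart e}
  chartAt p := (exists_hopfChart p).choose
  mem_chart_source p := (exists_hopfChart p).choose_spec.1
  chart_mem_atlas p := (exists_hopfChart p).choose_spec.2

/-- Two charts of the Hopf manifold differ locally by a power of `l`. -/
theorem hopf_transition {e e' : OpenPartialHomeomorph (HopfManifold V l) V}
    (he : IsHopfChart e) (he' : IsHopfChart e') {y : V} (hy : y ∈ (e.symm.trans e').source) :
    ∃ k : ℤ, ∀ᶠ x in 𝓝 y, e' (e.symm x) = l.val ^ k • x := by
  obtain ⟨c, hc, hgap⟩ := exists_hopf_gap l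
  have hc0 : 0 < c := by linarith
  have hlpos : 0 < ‖l.val‖ := norm_pos_iff.2 l.ne_zero
  have hk : ∀ x ∈ (e.symm.trans e').source, x ≠ 0 ∧ ∃ k : ℤ, e' (e.symm x) = l.val ^ k • x := by
    intro x hx
    rw [OpenPartialHomeomorph.trans_source] at hx
    have hx1 : x ∈ e.target := hx.1
    obtain ⟨h0, h1⟩ := he (e.symm x) (e.map_target hx1)
    obtain ⟨h0', h1'⟩ := he' (e.symm x) hx.2
    obtain ⟨k, hk⟩ := (hopfMk_eq_iff _ _).1 (h1.trans h1'.symm)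
    have hr : e (e.symm x) = x := e.right_inv hx1
    refine ⟨by rwa [hr] at h0, k, ?_⟩
    simpa [hr] using hk
  obtain ⟨hy0, k, hyk⟩ := hk y hy
  refine ⟨k, ?_⟩
  have hypos : 0 < ‖y‖ := norm_pos_iff.2 hy0
  let f : V → ℝ := fun x => ‖e' (e.symm x)‖ / ‖x‖ / ‖l.val‖ ^ k
  have hcont : ContinuousAt (fun x => e' (e.symm x)) y := (e.symm.trans e').continuousAt hy
  have hf : ContinuousAt f y :=
    (hcont.norm.div continuousAt_id.norm hypos.ne').div_const _
  have hf1 : f y = 1 := by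
    simp only [f, hyk, norm_smul, norm_zpow]
    have := zpow_pos hlpos k
    field_simp
  have hlo : (c ^ 2)⁻¹ < 1 := inv_lt_one_of_one_lt₀ (by nlinarith)
  have hhi : 1 < c ^ 2 := by nlinarith
  have e1 := hf.eventually (lt_mem_nhds (by rw [hf1]; exact hlo))
  have e2 := hf.eventually (gt_mem_nhds (by rw [hf1]; exact hhi))
  filter_upwards [e1, e2, (e.symm.trans e').open_source.mem_nhds hy] with x h1 h2 hx
  obtain ⟨hx0, m, hm⟩ := hk x hx
  have hxpos : 0 < ‖x‖ := norm_pos_iff.2 hx0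
  have hfx : f x = ‖l.val‖ ^ (m - k) := by
    simp only [f, hm, norm_smul, norm_zpow]
    rw [zpow_sub₀ hlpos.ne']
    field_simp
  rw [hfx] at h1 h2
  have := hgap (m - k) h1 h2
  have hmk : m = k := by omega
  rw [hm, hmk]

/-- The Hopf manifold is a complex manifold. -/
instance : IsManifold 𝓘(ℂ, V) ω (HopfManifold V l) := by
  refine isManifold_of_contDiffOn 𝓘(ℂ, V) ω (HopfManifold V l) ?_
  intro e e' he he'
  simp only [modelWithCornersSelf_coe, modelWithCornersSelf_coe_symm, Set.range_id,
    Set.preimage_id, Set.inter_univ, Function.id_comp, Function.comp_id]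
  intro y hy
  obtain ⟨k, hk⟩ := hopf_transition he he' hy
  refine ContDiffAt.contDiffWithinAt ?_
  exact (contDiffAt_id.const_smul (l.val ^ k)).congr_of_eventuallyEq hk

variable (V l)

/-- The constant `(1,1)`-form `ω₀(v, w) = g₀(Jv, w) = Im ⟪v, w⟫` of the flat metric
`g₀ = Re ⟪·, ·⟫` (the inner product is conjugate linear in the first variable). -/
def flatForm : V [⋀^Fin 2]→L[ℝ] ℝ where
  toFun v := (inner ℂ (v 0) (v 1)).im
  map_update_add' m i x y := by
    have hd : ‹DecidableEq (Fin 2)› = instDecidableEqFin 2 := Subsingleton.elim _ _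
    subst hd
    fin_cases i
    · simp
    · simp
  map_update_smul' m i c x := by
    have hd : ‹DecidableEq (Fin 2)› = instDecidableEqFin 2 := Subsingleton.elim _ _
    subst hd
    fin_cases i
    · simp [← Complex.coe_smul, mul_comm]
    · simp [← Complex.coe_smul]
  cont := by fun_prop
  map_eq_zero_of_eq' v i j hv hij := by
    have h01 : v 0 = v 1 := by
      fin_cases i <;> fin_cases j <;> simp_all
    rw [h01]
    exact inner_self_im (𝕜 := ℂ) _

/-- The form `ω_H = ‖z‖⁻² ω₀` on the Hopf manifold. The preferred chart `chartAt V p` is a local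
section of the quotient map, whose value at `p` is a representative `z` of `p`, and tangent vectors
at `p` are represented in this chart. -/
def hopfForm : DiffForm V (HopfManifold V l) 2 :=
  fun p => (‖chartAt V p p‖ ^ 2)⁻¹ • flatForm V

/-- The pullback of `ω_H` to `V \ {0}` is `‖z‖⁻² ω₀`. -/
theorem hopfForm_pullback {e : OpenPartialHomeomorph (HopfManifold V l) V}
    (he : e ∈ atlas V (HopfManifold V l)) {z : V} (hz : z ∈ e.target) :
    (hopfForm V l).pullback (E' := V) (e.symm : V → HopfManifold V l) z
      = (‖z‖ ^ 2)⁻¹ • flatForm V := by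
  set p := e.symm z with hp
  have hz' : z ∈ (e.symm.trans (chartAt V p)).source := by
    rw [OpenPartialHomeomorph.trans_source]
    exact ⟨hz, mem_chart_source V p⟩
  obtain ⟨k, hk⟩ := hopf_transition he (chart_mem_atlas V p) hz'
  have hder : mfderiv 𝓘(ℝ, V) 𝓘(ℝ, V) (e.symm : V → HopfManifold V l) z
      = (l.val ^ k • ContinuousLinearMap.id ℂ V).restrictScalars ℝ := by
    have h1 : HasFDerivAt (fun x => chartAt V p (e.symm x))
        ((l.val ^ k • ContinuousLinearMap.id ℂ V).restrictScalars ℝ) z := by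
      have h2 : HasFDerivAt (fun x : V => l.val ^ k • x)
          ((l.val ^ k • ContinuousLinearMap.id ℂ V).restrictScalars ℝ) z :=
        ((hasFDerivAt_id (𝕜 := ℂ) z).const_smul (l.val ^ k)).restrictScalars ℝ
      exact h2.congr_of_eventuallyEq hk
    refine HasMFDerivAt.mfderiv ⟨e.symm.continuousAt hz, ?_⟩
    simp only [writtenInExtChartAt, extChartAt, mfld_simps]
    exact h1.hasFDerivWithinAt
  have hval : chartAt V p p = l.val ^ k • z := hk.self_of_nhds
  have hl : 0 < ‖l.val‖ ^ k := zpow_pos (norm_pos_iff.2 l.ne_zero) k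
  ext v
  have hl2 : (starRingEnd ℂ) (l.val ^ k) * l.val ^ k = (((‖l.val‖ ^ k) ^ 2 : ℝ) : ℂ) := by
    rw [← norm_zpow, ← Complex.normSq_eq_conj_mul_self, Complex.normSq_eq_norm_sq]
  have key : flatForm V (fun i => l.val ^ k • v i) = (‖l.val‖ ^ k) ^ 2 * flatForm V v := by
    change (inner ℂ (l.val ^ k • v 0) (l.val ^ k • v 1)).im = _ * (inner ℂ (v 0) (v 1)).im
    rw [inner_smul_left, inner_smul_right, ← mul_assoc, hl2, Complex.im_ofReal_mul]
  have hpull : (hopfForm V l).pullback (E' := V) (e.symm : V → HopfManifold V l) z v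
      = (‖chartAt V p p‖ ^ 2)⁻¹ * flatForm V (fun i => l.val ^ k • v i) := by
    simp only [DiffForm.pullback, hopfForm, hder]
    rfl
  rw [hpull, key, hval, norm_smul, norm_zpow, mul_pow, mul_inv]
  change _ = (‖z‖ ^ 2)⁻¹ * flatForm V v
  field_simp

/-- The homothety character of the covering `V \ {0} → (V \ {0}) / ⟨l • id⟩`, on its deck group
`ℤ`: the deck transformation `z ↦ l ^ k • z` multiplies the flat form `ω₀` by `|l| ^ (2 k)`. -/
def hopfCharacter : Multiplicative ℤ →* {r : ℝ // 0 < r} :=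
  zpowersHom _ ⟨‖l.val‖ ^ 2, pow_pos (norm_pos_iff.2 l.ne_zero) 2⟩

/-- The factors `|l| ^ (2 k)` are the homothety factors of the deck transformations. -/
theorem hopfCharacter_apply (k : ℤ) (v w : V) :
    flatForm V ![l.val ^ k • v, l.val ^ k • w]
      = (hopfCharacter l (Multiplicative.ofAdd k) : ℝ) * flatForm V ![v, w] := by
  have hl2 : (starRingEnd ℂ) (l.val ^ k) * l.val ^ k = (((‖l.val‖ ^ k) ^ 2 : ℝ) : ℂ) := by
    rw [← norm_zpow, ← Complex.normSq_eq_conj_mul_self, Complex.normSq_eq_norm_sq]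
  have hc : (hopfCharacter l (Multiplicative.ofAdd k) : ℝ) = (‖l.val‖ ^ k) ^ 2 := by
    simp only [hopfCharacter, zpowersHom_apply, toAdd_ofAdd]
    rw [Positive.coe_zpow]
    change (‖l.val‖ ^ 2) ^ k = _
    rw [← zpow_natCast, ← zpow_natCast, ← zpow_mul, ← zpow_mul, mul_comm]
  change (inner ℂ (l.val ^ k • v) (l.val ^ k • w)).im = _ * (inner ℂ v w).im
  rw [inner_smul_left, inner_smul_right, ← mul_assoc, hl2, Complex.im_ofReal_mul, hc]

variable {V l} {E : Type*} [NormedAddCommGroup E] [NormedSpace ℂ E]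
  {M : Type*} [TopologicalSpace M] [ChartedSpace E M]

/-- A (global) lcK immersion of `(M, Ω)` into the Hopf manifold: a holomorphic (complex analytic)
map `F` with `F^* ω_H = Ω`. -/
structure IsLCKImmersion (Ω : DiffForm E M 2) (F : M → HopfManifold V l) : Prop where
  holomorphic : ContMDiff 𝓘(ℂ, E) 𝓘(ℂ, V) ω F
  pullback_eq : (hopfForm V l).pullback F = Ω

end Hopf

/-! ### Kähler coverings, homothety character, automorphic potentials -/

/-- The group of deck transformations of `π : Y → X`. -/
def deckGroup {Y X : Type*} [TopologicalSpace Y] (π : Y → X) : Subgroup (Y ≃ₜ Y) where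
  carrier := {γ | ∀ y, π (γ y) = π y}
  mul_mem' := by
    intro a b ha hb y
    exact (ha (b y)).trans (hb y)
  one_mem' := fun _ => rfl
  inv_mem' := by
    intro a ha y
    have h := ha (a⁻¹ y)
    rw [show a (a⁻¹ y) = y from a.apply_symm_apply y] at h
    exact h.symm

section Covering

variable {E : Type*} [NormedAddCommGroup E] [NormedSpace ℂ E]
  {M : Type*} [TopologicalSpace M] [ChartedSpace E M]

/-- A Kähler covering of an lcK manifold with Lee form `θ`: a connected holomorphic Galois covering
`π : M' → M` together with a smooth function `h` on `M'` such that `π^* θ = dh`. -/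
structure KahlerCovering (θ : DiffForm E M 1) where
  carrier : Type w
  [topology : TopologicalSpace carrier]
  [charts : ChartedSpace E carrier]
  [manifold : IsManifold 𝓘(ℂ, E) ω carrier]
  [hausdorff : T2Space carrier]
  [connected : ConnectedSpace carrier]
  proj : carrier → M
  covering : IsCoveringMap proj
  surjective : Function.Surjective proj
  localDiffeo : IsLocalDiffeomorph 𝓘(ℂ, E) 𝓘(ℂ, E) ω proj
  galois : ∀ y y', proj y = proj y' → ∃ γ ∈ deckGroup proj, γ y = y'
  pot : carrier → ℝ
  smooth_pot : ContMDiff 𝓘(ℝ, E) 𝓘(ℝ, ℝ) ∞ pot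
  d_pot : θ.pullback proj = differential E pot

attribute [instance] KahlerCovering.topology KahlerCovering.charts KahlerCovering.manifold
  KahlerCovering.hausdorff KahlerCovering.connected

namespace KahlerCovering

variable {θ : DiffForm E M 1} (K : KahlerCovering.{w} θ)

/-- The deck transformation group `Γ` of a Kähler covering. -/
abbrev Deck : Type w := deckGroup K.proj

/-- The Kähler form `exp(-h) π^* Ω` on the covering space. -/
def kahlerForm (Ω : DiffForm E M 2) : DiffForm E K.carrier 2 :=
  fun y => Real.exp (-K.pot y) • Ω.pullback K.proj y

/-- `χ` is the homothety character: `γ^* ω' = χ(γ) ω'` for the Kähler form `ω'` of the covering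
and all deck transformations `γ`. -/
def IsHomothetyCharacter (Ω : DiffForm E M 2) (χ : K.Deck →* {r : ℝ // 0 < r}) : Prop :=
  ∀ (γ : K.Deck), (K.kahlerForm Ω).pullback (γ : K.carrier ≃ₜ K.carrier)
    = fun y => (χ γ : ℝ) • K.kahlerForm Ω y

/-- `ψ` is a positive automorphic potential of the Kähler form `ω'` of the covering:
`ω' = d d^c ψ` and `γ^* ψ = χ(γ) ψ` for all deck transformations `γ`. -/
structure IsAutomorphicPotential (Ω : DiffForm E M 2) (χ : K.Deck →* {r : ℝ // 0 < r})
    (ψ : K.carrier → ℝ) : Prop where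
  smooth : ContMDiff 𝓘(ℝ, E) 𝓘(ℝ, ℝ) ∞ ψ
  pos : ∀ y, 0 < ψ y
  ddc_eq : ddc E ψ = K.kahlerForm Ω
  automorphic : ∀ (γ : K.Deck) (y : K.carrier),
    ψ ((γ : K.carrier ≃ₜ K.carrier) y) = (χ γ : ℝ) * ψ y

/-- The positive function `ψ` is proper as a map to the half-line `(0, ∞)`. -/
def IsProperPotential (ψ : K.carrier → ℝ) : Prop :=
  ∃ hψ : ∀ y, 0 < ψ y, IsProperMap (fun y => (⟨ψ y, hψ y⟩ : {r : ℝ // 0 < r}))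

/-- `F'` is a holomorphic lift, to the Kähler covering and to `V \ {0}`, of a map `F` into a Hopf
manifold. -/
structure IsHolomorphicLift {V : Type*} [NormedAddCommGroup V] [InnerProductSpace ℂ V]
    {l : HopfParameter} (F : M → HopfManifold V l) (F' : K.carrier → V) : Prop where
  holomorphic : ContMDiff 𝓘(ℂ, E) 𝓘(ℂ, V) ω F'
  lift : ∀ y, IsHopfLift (F' y) (F (K.proj y))

/-- The lcK rank: the rank of the image of the homothety character, an abelian group. -/
def lckRank {K : KahlerCovering.{w} θ} (χ : K.Deck →* {r : ℝ // 0 < r}) : Cardinal :=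
  Module.rank ℤ (Additive χ.range)

end KahlerCovering

end Covering

end

/-! A point of the Hopf manifold determines a vector of `V \ {0}` up to powers of `λ`, and as `|λ| ≠
1` the norm alone tells these representatives apart. Locally `F` lifts to a holomorphic map `f` into
`V \ {0}`, and `Ω = ‖f‖⁻² dd^c‖f‖²` (`pullback_hopfForm_eq`, `ddc_norm_sq`). Hence `dΩ = -d log‖f‖²
∧ Ω`. In complex dimension at least 2, wedging with a positive `(1,1)`-form is injective on 1-forms,
so `θ = -d log‖f‖²` (`lee_eq_differential`).

On a Kähler covering `π^*θ = dh`, so `h + log‖f‖²` is locally constant for every local lift `f` of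
`F ∘ π`. Prescribing its value selects one representative at each point, and these form a global
holomorphic lift `F'` with `c‖F'‖² = e^{-h}` (`exists_isHolomorphicLift`). Therefore `e^{-h} π^*Ω =
dd^c(c‖F'‖²)`. A deck transformation `γ` multiplies `F'` by a power `λ^{κ(γ)}`, so the homothety
character is `χ₀ ∘ κ` and its image lies in that of `χ₀`.

The rank is 1 because `κ` is not trivial: otherwise `‖F'‖` would come from the compact `M` and
attain a maximum, and the maximum principle would make `F` locally constant, against `Ω > 0`
(`exists_deck_ne_one`). If `κ` is injective the potential is proper, since some compact set meets
every deck orbit and only finitely many of its translates meet a given compact range of values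
(`isProperPotential_exp_neg_pot`).

A minimal covering is a connected component of the pullback by `F` of `V \ {0} → (V \ {0}) / ⟨λ⟩`:
there the lift is the second projection, and a deck transformation fixing it is the identity
(`exists_minimal_kahlerCovering`). -/

noncomputable section

/-! ### Passing from complex to real derivatives on manifolds -/

section RestrictScalars

variable {E : Type*} [NormedAddCommGroup E] [NormedSpace ℂ E]
  {M : Type*} [TopologicalSpace M] [ChartedSpace E M]
  {E' : Type*} [NormedAddCommGroup E'] [NormedSpace ℂ E']
  {N : Type*} [TopologicalSpace N] [ChartedSpace E' N]

theorem HasMFDerivAt.restrictScalars_real {f : M → N} {x : M} {f' : E →L[ℂ] E'}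
    (h : HasMFDerivAt 𝓘(ℂ, E) 𝓘(ℂ, E') f x f') :
    HasMFDerivAt 𝓘(ℝ, E) 𝓘(ℝ, E') f x (f'.restrictScalars ℝ) :=
  ⟨h.1, HasFDerivWithinAt.restrictScalars ℝ h.2⟩

theorem MDifferentiableAt.restrictScalars_real {f : M → N} {x : M}
    (h : MDifferentiableAt 𝓘(ℂ, E) 𝓘(ℂ, E') f x) : MDifferentiableAt 𝓘(ℝ, E) 𝓘(ℝ, E') f x :=
  (HasMFDerivAt.restrictScalars_real h.hasMFDerivAt).mdifferentiableAt

theorem MDifferentiableAt.mfderiv_real_eq {f : M → N} {x : M}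
    (h : MDifferentiableAt 𝓘(ℂ, E) 𝓘(ℂ, E') f x) :
    mfderiv 𝓘(ℝ, E) 𝓘(ℝ, E') f x
      = (mfderiv 𝓘(ℂ, E) 𝓘(ℂ, E') f x : E →L[ℂ] E').restrictScalars ℝ :=
  (HasMFDerivAt.restrictScalars_real h.hasMFDerivAt).mfderiv

theorem ContMDiffAt.restrictScalars_real {n : WithTop ℕ∞} {f : M → N} {x : M}
    (h : ContMDiffAt 𝓘(ℂ, E) 𝓘(ℂ, E') n f x) : ContMDiffAt 𝓘(ℝ, E) 𝓘(ℝ, E') n f x := by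
  rw [contMDiffAt_iff] at h ⊢
  exact ⟨h.1, ContDiffWithinAt.restrict_scalars ℝ h.2⟩

theorem mdifferentiableAt_chartAt_symm [IsManifold 𝓘(ℂ, E) ω M] (x : M) {y : E}
    (hy : y ∈ (chartAt E x).target) :
    MDifferentiableAt 𝓘(ℂ, E) 𝓘(ℂ, E) (chartAt E x).symm y :=
  ((contMDiffOn_chart_symm (n := ω) (I := 𝓘(ℂ, E)) (x := x)).contMDiffAt
    ((chartAt E x).open_target.mem_nhds hy)).mdifferentiableAt (by simp)

/-- Tangent vectors at `x` are written in the preferred chart at `x`, so the inverse of that chart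
is the identity to first order there. -/
theorem mfderiv_chartAt_symm_self (x : M) :
    mfderiv 𝓘(ℝ, E) 𝓘(ℝ, E) ((chartAt E x).symm : E → M) (chartAt E x x)
      = ContinuousLinearMap.id ℝ E := by
  refine HasMFDerivAt.mfderiv
    ⟨(chartAt E x).continuousAt_symm (mem_chart_target E x), ?_⟩
  simp only [writtenInExtChartAt, extChartAt, mfld_simps]
  rw [(chartAt E x).left_inv (mem_chart_source E x)]
  refine HasFDerivAt.hasFDerivWithinAt ((hasFDerivAt_id _).congr_of_eventuallyEq ?_)
  filter_upwards [(chartAt E x).open_target.mem_nhds (mem_chart_target E x)] with z hz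
  exact (chartAt E x).right_inv hz

end RestrictScalars

/-! ### Pullbacks -/

section Pullback

variable {E : Type*} [NormedAddCommGroup E] [NormedSpace ℂ E]
  {M : Type*} [TopologicalSpace M] [ChartedSpace E M]
  {E' : Type*} [NormedAddCommGroup E'] [NormedSpace ℂ E']
  {N : Type*} [TopologicalSpace N] [ChartedSpace E' N]
  {E'' : Type*} [NormedAddCommGroup E''] [NormedSpace ℂ E'']
  {P : Type*} [TopologicalSpace P] [ChartedSpace E'' P]

theorem DiffForm.pullback_pullback {k : ℕ} (Ω : DiffForm E M k) {f : N → M} {g : P → N} {y : P}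
    (hf : MDifferentiableAt 𝓘(ℝ, E') 𝓘(ℝ, E) f (g y))
    (hg : MDifferentiableAt 𝓘(ℝ, E'') 𝓘(ℝ, E') g y) :
    DiffForm.pullback (E := E') (E' := E'') g (DiffForm.pullback (E := E) (E' := E') f Ω) y
      = DiffForm.pullback (E := E) (E' := E'') (f ∘ g) Ω y := by
  simp only [DiffForm.pullback, mfderiv_comp y hf hg]
  rfl

theorem DiffForm.pullback_chartAt_symm_self {k : ℕ} (Ω : DiffForm E M k) (x : M) :
    Ω.pullback (E' := E) ((chartAt E x).symm : E → M) (chartAt E x x) = Ω x := by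
  simp only [DiffForm.pullback, mfderiv_chartAt_symm_self]
  rw [(chartAt E x).left_inv (mem_chart_source E x)]
  rfl

theorem DiffForm.pullback_congr {k : ℕ} (Ω : DiffForm E M k) {f g : N → M} {y : N}
    (h : f =ᶠ[𝓝 y] g) : DiffForm.pullback (E' := E') f Ω y = DiffForm.pullback (E' := E') g Ω y := by
  simp only [DiffForm.pullback, h.mfderiv_eq, h.self_of_nhds]

theorem differential_pullback {f : N → M} {φ : M → ℝ} {y : N}
    (hφ : MDifferentiableAt 𝓘(ℝ, E) 𝓘(ℝ, ℝ) φ (f y))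
    (hf : MDifferentiableAt 𝓘(ℝ, E') 𝓘(ℝ, E) f y) :
    DiffForm.pullback (E := E) (E' := E') f (differential E φ) y = differential E' (φ ∘ f) y := by
  simp only [DiffForm.pullback, differential, mfderiv_comp y hφ hf]
  rfl

theorem differential_eq_iff {φ φ' : M → ℝ} {x : M} :
    differential E φ x = differential E φ' x ↔
      mfderiv 𝓘(ℝ, E) 𝓘(ℝ, ℝ) φ x = (mfderiv 𝓘(ℝ, E) 𝓘(ℝ, ℝ) φ' x : E →L[ℝ] ℝ) :=
  (ContinuousAlternatingMap.ofSubsingleton ℝ E ℝ (0 : Fin 1)).injective.eq_iff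

end Pullback

/-! ### The flat form and the squared norm of a holomorphic map -/

section Flat

attribute [local instance] InnerProductSpace.complexToReal

variable {E : Type*} [NormedAddCommGroup E] [NormedSpace ℂ E]
  {M : Type*} [TopologicalSpace M] [ChartedSpace E M]
  (V : Type*) [NormedAddCommGroup V] [InnerProductSpace ℂ V]

theorem Complex.inner_real_eq {V : Type*} [NormedAddCommGroup V] [InnerProductSpace ℂ V] (z w : V) :
    inner ℝ z w = (inner ℂ z w).re := rfl

theorem inner_im_antisymm {V : Type*} [NormedAddCommGroup V] [InnerProductSpace ℂ V] (z w : V) :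
    (inner ℂ z w).im = -(inner ℂ w z).im := by
  rw [← inner_conj_symm, Complex.conj_im]

/-- The primitive `d^c ‖z‖²` of the flat form. -/
def flatPrimitive : DiffForm V V 1 := fun z =>
  ContinuousAlternatingMap.ofSubsingleton ℝ V ℝ (0 : Fin 1)
    ((1 / 2 : ℝ) • innerSL ℝ (Complex.I • z))

variable {V}

theorem flatPrimitive_apply (z : V) (v : Fin 1 → V) :
    flatPrimitive V z v = (1 / 2) * (inner ℂ z (v 0)).im := by
  simp [flatPrimitive, Complex.inner_real_eq]

theorem flatForm_apply (v : Fin 2 → V) : flatForm V v = (inner ℂ (v 0) (v 1)).im := rfl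

theorem differentiable_flatPrimitive : Differentiable ℝ (flatPrimitive V) := by
  have h : flatPrimitive V = fun z =>
      ContinuousAlternatingMap.ofSubsingletonLIE (𝕜 := ℝ) (E := V) (F := ℝ) (0 : Fin 1)
      ((1 / 2 : ℝ) • innerSL ℝ (complexStructure V z)) := rfl
  have h1 : IsBoundedLinearMap ℝ (fun z : V => innerSL ℝ z) :=
    ⟨⟨map_add _, fun c z => by simp⟩, 1, one_pos, fun z => by simp⟩
  rw [h]
  exact (LinearIsometryEquiv.differentiable _).comp
    ((h1.differentiable.comp (complexStructure V).differentiable).fun_const_smul _)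

/-- The primitive is linear in `z`. Its two alternating terms are equal because `Im ⟪·, ·⟫` is
antisymmetric, which absorbs the factor `1 / 2`. -/
theorem extDeriv_flatPrimitive (z : V) : extDeriv (flatPrimitive V) z = flatForm V := by
  ext v
  have hd : ∀ a b : V, fderiv ℝ (fun z : V => 1 / 2 * (inner ℂ z a).im) z b
      = 1 / 2 * (inner ℂ b a).im := by
    intro a b
    have : (fun z : V => 1 / 2 * (inner ℂ z a).im)
        = (-(1 / 2 : ℝ)) • (innerSL ℝ (Complex.I • a)) := by
      ext z
      simp [Complex.inner_real_eq, inner_im_antisymm z a]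
    rw [this, ← FunLike.coe_smul, ContinuousLinearMap.fderiv]
    simp [Complex.inner_real_eq, inner_im_antisymm b a]
  rw [extDeriv_apply (differentiable_flatPrimitive z), Fin.sum_univ_two, flatForm_apply]
  simp only [flatPrimitive_apply, hd, Fin.removeNth]
  simp [inner_im_antisymm (v 1) (v 0)]
  ring

/-- The derivative of `f` commutes with `J`, and `-(1/4) · 2 Re ⟪z, iv⟫ = (1/2) Im ⟪z, v⟫`. -/
theorem dc_norm_sq {f : M → V} {y : M} (hf : MDifferentiableAt 𝓘(ℂ, E) 𝓘(ℂ, V) f y) :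
    dc E (fun x => ‖f x‖ ^ 2) y = (flatPrimitive V).pullback f y := by
  have h1 := (HasMFDerivAt.restrictScalars_real hf.hasMFDerivAt)
  have h2 : HasMFDerivAt 𝓘(ℝ, V) 𝓘(ℝ, ℝ) (fun z : V => ‖z‖ ^ 2) (f y)
      (2 • innerSL ℝ (f y)) := (hasStrictFDerivAt_norm_sq (f y)).hasFDerivAt.hasMFDerivAt
  have h3 : mfderiv 𝓘(ℝ, E) 𝓘(ℝ, ℝ) (fun x => ‖f x‖ ^ 2) y = _ := (h2.comp y h1).mfderiv
  ext v
  simp only [dc, differential, h3, DiffForm.pullback, h1.mfderiv]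
  have key : ∀ L : E →L[ℂ] V, -(1 / 4) * ((2 : ℕ) • inner ℝ (f y) (L (Complex.I • v 0)))
      = (flatPrimitive V (f y)).compContinuousLinearMap (L.restrictScalars ℝ) v := by
    intro L
    rw [ContinuousAlternatingMap.compContinuousLinearMap_apply, flatPrimitive_apply, map_smul]
    simp [Complex.inner_real_eq]
    ring
  exact key _

theorem ddc_norm_sq [IsManifold 𝓘(ℂ, E) ω M] {f : M → V} {y : M}
    (hf : ContMDiffAt 𝓘(ℂ, E) 𝓘(ℂ, V) ω f y) :
    ddc E (fun x => ‖f x‖ ^ 2) y = DiffForm.pullback f (fun _ => flatForm V) y := by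
  have hf' : ∀ᶠ x in 𝓝 y, MDifferentiableAt 𝓘(ℂ, E) 𝓘(ℂ, V) f x :=
    (contMDiffAt_iff_contMDiffAt_nhds (by simp) |>.1 hf).mono fun x hx => hx.mdifferentiableAt (by simp)
  set φ := chartAt E y with hφ
  have hyt : φ y ∈ φ.target := mem_chart_target E y
  have hys : φ.symm (φ y) = y := φ.left_inv (mem_chart_source E y)
  have hcont : ContinuousAt φ.symm (φ y) := φ.continuousAt_symm hyt
  -- The exterior derivative depends on the germ, so the identity for `d^c‖f‖²` is needed near the
  -- point and in one fixed chart; then `d` commutes with the pullback by `f ∘ φ.symm`.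
  have hev : (dc E (fun x => ‖f x‖ ^ 2)).pullback (E' := E) (φ.symm : E → M) =ᶠ[𝓝 (φ y)]
      fun x => (flatPrimitive V (f (φ.symm x))).compContinuousLinearMap
        (fderiv ℝ (f ∘ φ.symm) x) := by
    have h1 : ∀ᶠ x in 𝓝 (φ y), MDifferentiableAt 𝓘(ℂ, E) 𝓘(ℂ, V) f (φ.symm x) := by
      refine hcont.eventually ?_
      rwa [hys]
    filter_upwards [h1, φ.open_target.mem_nhds hyt] with x hx hxt
    have h2 : (dc E (fun x => ‖f x‖ ^ 2)).pullback (E' := E) (φ.symm : E → M) x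
        = DiffForm.pullback (E := E) (E' := E) (φ.symm : E → M)
          (DiffForm.pullback (E := V) (E' := E) f (flatPrimitive V)) x := by
      simp only [DiffForm.pullback, dc_norm_sq hx]
    rw [h2, DiffForm.pullback_pullback _ hx.restrictScalars_real
      (mdifferentiableAt_chartAt_symm y hxt).restrictScalars_real, DiffForm.pullback,
      mfderiv_eq_fderiv]
    rfl
  have hfc : ContDiffAt ℝ ω (f ∘ φ.symm) (φ y) := by
    have : ContMDiffAt 𝓘(ℂ, E) 𝓘(ℂ, V) ω (f ∘ φ.symm) (φ y) := by
      refine ContMDiffAt.comp (φ y) (by rwa [hys]) ?_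
      exact (contMDiffOn_chart_symm (n := ω) (I := 𝓘(ℂ, E)) (x := y)).contMDiffAt
        ((chartAt E y).open_target.mem_nhds hyt)
    exact this.contDiffAt.restrict_scalars ℝ
  rw [ddc, DiffForm.d, hev.extDeriv_eq]
  have := extDeriv_pullback (x := φ y) (f := f ∘ φ.symm)
    (differentiable_flatPrimitive (V := V) _) hfc
    (by simp)
  simp only [Function.comp_apply] at this
  rw [this, extDeriv_flatPrimitive]
  simp only [DiffForm.pullback]
  congr 1
  rw [(hf.mdifferentiableAt (by simp)).restrictScalars_real.mfderiv]
  simp [writtenInExtChartAt, extChartAt, hφ]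
  rfl

end Flat

/-! ### Continuous lifts of maps into a Hopf manifold -/

section HopfLift

variable {V : Type*} [NormedAddCommGroup V] [InnerProductSpace ℂ V] {l : HopfParameter}

theorem HopfParameter.norm_pos (l : HopfParameter) : 0 < ‖l.val‖ := norm_pos_iff.2 l.ne_zero

theorem HopfParameter.norm_zpow_eq_one {l : HopfParameter} {k : ℤ} (h : ‖l.val‖ ^ k = 1) :
    k = 0 := by
  obtain ⟨c, hc, hgap⟩ := exists_hopf_gap l
  refine hgap k ?_ ?_
  · rw [h]; exact inv_lt_one_of_one_lt₀ (by nlinarith)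
  · rw [h]; nlinarith

theorem IsHopfLift.ne_zero {z : V} {p : HopfManifold V l} (h : IsHopfLift z p) : z ≠ 0 := h.1

theorem IsHopfLift.exists_zpow {z z' : V} {p : HopfManifold V l} (h : IsHopfLift z p)
    (h' : IsHopfLift z' p) : ∃ k : ℤ, z' = l.val ^ k • z := by
  obtain ⟨hz, hp⟩ := h
  obtain ⟨hz', hp'⟩ := h'
  exact (hopfMk_eq_iff _ _).1 (hp.trans hp'.symm)

theorem IsHopfLift.zpow_smul {z : V} {p : HopfManifold V l} (h : IsHopfLift z p) (k : ℤ) :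
    IsHopfLift (l.val ^ k • z) p := by
  obtain ⟨hz, hp⟩ := h
  refine ⟨smul_ne_zero (zpow_ne_zero _ l.ne_zero) hz, ?_⟩
  rw [← hp]
  exact ((hopfMk_eq_iff _ _).2 ⟨k, rfl⟩).symm

theorem IsHopfLift.eq {z : V} {p q : HopfManifold V l} (h : IsHopfLift z p)
    (h' : IsHopfLift z q) : p = q := by
  obtain ⟨hz, hp⟩ := h
  obtain ⟨hz', hp'⟩ := h'
  exact hp.symm.trans hp'

theorem IsHopfLift.zpow_unique {z : V} {p : HopfManifold V l} (h : IsHopfLift z p) {k m : ℤ}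
    (hkm : ‖l.val ^ k • z‖ = ‖l.val ^ m • z‖) : k = m := by
  have hz : ‖z‖ ≠ 0 := norm_ne_zero_iff.2 h.ne_zero
  rw [norm_smul, norm_smul, norm_zpow, norm_zpow] at hkm
  have h1 := mul_right_cancel₀ hz hkm
  have h2 : ‖l.val‖ ^ (k - m) = 1 := by
    rw [zpow_sub₀ l.norm_pos.ne', h1, div_self (zpow_pos l.norm_pos m).ne']
  have := HopfParameter.norm_zpow_eq_one h2
  omega

/-- Representatives differ by a power of `l`, and a nonzero power changes the norm because `|l| ≠
1`. -/
theorem IsHopfLift.eq_of_norm_eq {z z' : V} {p : HopfManifold V l} (h : IsHopfLift z p)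
    (h' : IsHopfLift z' p) (hn : ‖z‖ = ‖z'‖) : z = z' := by
  obtain ⟨k, rfl⟩ := h.exists_zpow h'
  have : k = 0 := (h.zpow_unique (k := 0) (m := k) (by simpa using hn)).symm
  simp [this]

theorem exists_isHopfLift (p : HopfManifold V l) : ∃ z, IsHopfLift z p := by
  obtain ⟨z, hz⟩ : ∃ z, hopfMk l z = p := Quotient.exists_rep p
  exact ⟨z, z.2, hz⟩

theorem isHopfLift_chartAt {p q : HopfManifold V l} (hq : q ∈ (chartAt V p).source) :
    IsHopfLift (chartAt V p q) q :=
  (chart_mem_atlas V p : IsHopfChart _) q hq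

/-- Two continuous local lifts of the same map differ locally by a power of `l`. -/
theorem eventually_eq_zpow_smul {T : Type*} [TopologicalSpace T] {g g' : T → V}
    {f : T → HopfManifold V l} {t : T} (hg : ContinuousAt g t) (hg' : ContinuousAt g' t)
    (h : ∀ᶠ s in 𝓝 t, IsHopfLift (g s) (f s)) (h' : ∀ᶠ s in 𝓝 t, IsHopfLift (g' s) (f s)) :
    ∃ k : ℤ, ∀ᶠ s in 𝓝 t, g' s = l.val ^ k • g s := by
  obtain ⟨c, hc, hgap⟩ := exists_hopf_gap l
  obtain ⟨k, hk⟩ := h.self_of_nhds.exists_zpow h'.self_of_nhds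
  have hpos : 0 < ‖g t‖ := norm_pos_iff.2 h.self_of_nhds.ne_zero
  have hlpos := l.norm_pos
  refine ⟨k, ?_⟩
  -- The ratio of norms, normalised to be 1 at `t`, takes only values `‖l‖ ^ n`; by continuity it
  -- stays in the gap around 1 which isolates `n = 0`.
  let r : T → ℝ := fun s => ‖g' s‖ / ‖g s‖ / ‖l.val‖ ^ k
  have hr : ContinuousAt r t := (hg'.norm.div hg.norm hpos.ne').div_const _
  have hr1 : r t = 1 := by
    simp only [r, hk, norm_smul, norm_zpow]
    have := zpow_pos hlpos k
    field_simp
  have hlo : (c ^ 2)⁻¹ < 1 := inv_lt_one_of_one_lt₀ (by nlinarith)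
  have hhi : 1 < c ^ 2 := by nlinarith
  filter_upwards [hr.eventually (lt_mem_nhds (by rw [hr1]; exact hlo)),
    hr.eventually (gt_mem_nhds (by rw [hr1]; exact hhi)), h, h'] with s h1 h2 hs hs'
  obtain ⟨m, hm⟩ := hs.exists_zpow hs'
  have hspos : 0 < ‖g s‖ := norm_pos_iff.2 hs.ne_zero
  have hrs : r s = ‖l.val‖ ^ (m - k) := by
    simp only [r, hm, norm_smul, norm_zpow]
    rw [zpow_sub₀ hlpos.ne']
    field_simp
  rw [hrs] at h1 h2
  have := hgap (m - k) h1 h2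
  have hmk : m = k := by omega
  rw [hm, hmk]

variable {E : Type*} [NormedAddCommGroup E] [NormedSpace ℂ E]
  {N : Type*} [TopologicalSpace N] [ChartedSpace E N]

/-- A continuous local lift is locally a chart composed with the map, up to a power of `l`. -/
theorem eventually_eq_zpow_smul_chartAt {G : N → HopfManifold V l} {g : N → V} {y : N}
    (hG : ContinuousAt G y) (hg : ContinuousAt g y) (h : ∀ᶠ x in 𝓝 y, IsHopfLift (g x) (G x)) :
    ∃ k : ℤ, ∀ᶠ x in 𝓝 y, g x = l.val ^ k • chartAt V (G y) (G x) := by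
  have hs : ∀ᶠ x in 𝓝 y, G x ∈ (chartAt V (G y)).source :=
    hG.eventually ((chartAt V (G y)).open_source.mem_nhds (mem_chart_source V _))
  refine eventually_eq_zpow_smul ?_ hg (hs.mono fun x hx => isHopfLift_chartAt hx) h
  exact ((chartAt V (G y)).continuousAt (mem_chart_source V _)).comp_of_eq hG rfl

theorem contMDiffAt_chartAt_comp {G : N → HopfManifold V l} {y : N}
    (hG : ContMDiffAt 𝓘(ℂ, E) 𝓘(ℂ, V) ω G y) :
    ContMDiffAt 𝓘(ℂ, E) 𝓘(ℂ, V) ω (fun x => chartAt V (G y) (G x)) y :=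
  ContMDiffAt.comp (g := chartAt V (G y)) y
    ((contMDiffOn_chart (n := ω) (I := 𝓘(ℂ, V)) (x := G y)).contMDiffAt
      ((chartAt V (G y)).open_source.mem_nhds (mem_chart_source V _))) hG

/-- Continuity of a lift is enough: locally it is a constant multiple of a holomorphic chart
composed with `G`. -/
theorem contMDiffAt_of_isHopfLift {G : N → HopfManifold V l} {g : N → V} {y : N}
    (hG : ContMDiffAt 𝓘(ℂ, E) 𝓘(ℂ, V) ω G y) (hg : ContinuousAt g y)
    (h : ∀ᶠ x in 𝓝 y, IsHopfLift (g x) (G x)) : ContMDiffAt 𝓘(ℂ, E) 𝓘(ℂ, V) ω g y := by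
  obtain ⟨k, hk⟩ := eventually_eq_zpow_smul_chartAt hG.continuousAt hg h
  exact ((l.val ^ k • ContinuousLinearMap.id ℂ V).contMDiff.contMDiffAt.comp y
    (contMDiffAt_chartAt_comp hG)).congr_of_eventuallyEq hk

theorem flatForm_smul (c : ℂ) (v : Fin 2 → V) :
    flatForm V (fun i => c • v i) = ‖c‖ ^ 2 * flatForm V v := by
  have hc : (starRingEnd ℂ) c * c = ((‖c‖ ^ 2 : ℝ) : ℂ) := by
    rw [← Complex.normSq_eq_conj_mul_self, Complex.normSq_eq_norm_sq]
  rw [flatForm_apply, flatForm_apply, inner_smul_left, inner_smul_right, ← mul_assoc, hc,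
    Complex.im_ofReal_mul]

/-- The pullback of `ω_H` in terms of a continuous local lift. -/
theorem pullback_hopfForm_eq {G : N → HopfManifold V l} {g : N → V} {y : N}
    (hG : ContMDiffAt 𝓘(ℂ, E) 𝓘(ℂ, V) ω G y) (hg : ContinuousAt g y)
    (h : ∀ᶠ x in 𝓝 y, IsHopfLift (g x) (G x)) :
    DiffForm.pullback (E := V) (E' := E) G (hopfForm V l) y
      = (‖g y‖ ^ 2)⁻¹ • DiffForm.pullback (E := V) (E' := E) g (fun _ => flatForm V) y := by
  obtain ⟨k, hk⟩ := eventually_eq_zpow_smul_chartAt hG.continuousAt hg h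
  set e := chartAt V (G y) with he
  have hs : ∀ᶠ x in 𝓝 y, G x ∈ e.source :=
    hG.continuousAt.eventually (e.open_source.mem_nhds (mem_chart_source V _))
  have hGe : G =ᶠ[𝓝 y] e.symm ∘ fun x => e (G x) := hs.mono fun x hx => (e.left_inv hx).symm
  have het : e (G y) ∈ e.target := mem_chart_target V (G y)
  have hd := (contMDiffAt_chartAt_comp hG).mdifferentiableAt (by simp)
  have hsymm : MDifferentiableAt 𝓘(ℂ, V) 𝓘(ℂ, V) e.symm (e (G y)) :=
    mdifferentiableAt_chartAt_symm (G y) het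
  have hcomp := DiffForm.pullback_pullback (hopfForm V l) (f := e.symm) (g := fun x => e (G x))
    (y := y) hsymm.restrictScalars_real hd.restrictScalars_real
  rw [DiffForm.pullback_congr _ hGe, ← hcomp]
  have hdg : mfderiv 𝓘(ℝ, E) 𝓘(ℝ, V) g y
      = ((l.val ^ k • (mfderiv 𝓘(ℂ, E) 𝓘(ℂ, V) (fun x => e (G x)) y :
        E →L[ℂ] V)).restrictScalars ℝ) :=
    (HasMFDerivAt.restrictScalars_real
      ((hd.hasMFDerivAt.const_smul (l.val ^ k)).congr_of_eventuallyEq hk)).mfderiv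
  have hgy : ‖g y‖ ^ 2 = ‖l.val ^ k‖ ^ 2 * ‖e (G y)‖ ^ 2 := by
    rw [hk.self_of_nhds, norm_smul, mul_pow]
  have hl : ‖l.val ^ k‖ ≠ 0 := norm_ne_zero_iff.2 (zpow_ne_zero k l.ne_zero)
  ext v
  -- Replacing the chart lift by `l ^ k` times it multiplies `‖·‖²` and the pulled back flat form by
  -- the same factor `‖l ^ k‖²`, so the quotient is unchanged.
  have key : ∀ L : E →L[ℂ] V, (((‖e (G y)‖ ^ 2)⁻¹ • flatForm V).compContinuousLinearMap
        (L.restrictScalars ℝ)) v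
      = ((‖g y‖ ^ 2)⁻¹ • (flatForm V).compContinuousLinearMap
        ((l.val ^ k • L).restrictScalars ℝ)) v := by
    intro L
    have h3 : (flatForm V).compContinuousLinearMap ((l.val ^ k • L).restrictScalars ℝ) v
        = ‖l.val ^ k‖ ^ 2 * flatForm V (fun i => L (v i)) := flatForm_smul (l.val ^ k) fun i => L (v i)
    rw [ContinuousAlternatingMap.smul_apply, h3, hgy, smul_eq_mul, mul_inv]
    change (‖e (G y)‖ ^ 2)⁻¹ * flatForm V (fun i => L (v i)) = _
    field_simp
  have hp := hopfForm_pullback (V := V) (l := l) (chart_mem_atlas V (G y)) het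
  have h1 : DiffForm.pullback (E := V) (E' := E) (fun x => e (G x))
      (DiffForm.pullback (E := V) (E' := V) e.symm (hopfForm V l)) y
      = (((‖e (G y)‖ ^ 2)⁻¹ • flatForm V).compContinuousLinearMap
        ((mfderiv 𝓘(ℂ, E) 𝓘(ℂ, V) (fun x => e (G x)) y : E →L[ℂ] V).restrictScalars ℝ)) := by
    rw [DiffForm.pullback, hd.mfderiv_real_eq, ← hp]
    rfl
  rw [h1, DiffForm.pullback, hdg]
  exact key _

end HopfLift

/-! ### The Lee form -/

section Lee

variable {E : Type*} [NormedAddCommGroup E] [NormedSpace ℂ E]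

/-- This is where dimension at least 2 enters: `τ` vanishes on some complex line, and evaluating `τ
∧ B = 0` on `v`, `w`, `iw` with `w` spanning that line leaves only `τ v * B w (iw)`. -/
theorem eq_zero_of_wedge_eq_zero [FiniteDimensional ℂ E] (hdim : 2 ≤ Module.finrank ℂ E)
    (τ : E →L[ℝ] ℝ) (B : E → E → ℝ) (hB : ∀ w, w ≠ 0 → B w (Complex.I • w) ≠ 0)
    (h : ∀ v₀ v₁ v₂, τ v₀ * B v₁ v₂ - τ v₁ * B v₀ v₂ + τ v₂ * B v₀ v₁ = 0) : τ = 0 := by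
  -- The complex functional with real part `τ` has a nonzero kernel vector `w`; its real and
  -- imaginary parts there give `τ w = 0` and `τ (iw) = 0`.
  obtain ⟨w, hw, hw0⟩ := (Submodule.ne_bot_iff _).1
    (LinearMap.ker_ne_bot_of_finrank_lt (f := (StrongDual.extendRCLike (𝕜 := ℂ) τ : E →ₗ[ℂ] ℂ))
      (by simpa using (by omega : 1 < Module.finrank ℂ E)))
  have hw' : StrongDual.extendRCLike (𝕜 := ℂ) τ w = 0 := hw
  have h1 : τ w = 0 := by
    have := congrArg Complex.re hw'
    simpa [StrongDual.extendRCLike_apply] using this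
  have h2 : τ (Complex.I • w) = 0 := by
    have := congrArg Complex.im hw'
    simpa [StrongDual.extendRCLike_apply] using this
  ext v
  have := h v w (Complex.I • w)
  rw [h1, h2] at this
  simpa [hB w hw0] using this

theorem extDeriv_const {k : ℕ} {W : Type*} [NormedAddCommGroup W] [NormedSpace ℝ W]
    (α : W [⋀^Fin k]→L[ℝ] ℝ) (x : W) : extDeriv (fun _ => α) x = 0 := by
  ext v
  simp [extDeriv, ContinuousAlternatingMap.alternatizeUncurryFin_apply]

/-- The exterior derivative of a function times a closed two-form. -/
theorem extDeriv_smul_of_closed {W : Type*} [NormedAddCommGroup W] [NormedSpace ℝ W]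
    {a : W → ℝ} {η : W → W [⋀^Fin 2]→L[ℝ] ℝ} {x : W} {a' : W →L[ℝ] ℝ} (ha : HasFDerivAt a a' x)
    (hη : DifferentiableAt ℝ η x) (hcl : extDeriv η x = 0) (v₀ v₁ v₂ : W) :
    extDeriv (fun y => a y • η y) x ![v₀, v₁, v₂]
      = a' v₀ * η x ![v₁, v₂] - a' v₁ * η x ![v₀, v₂] + a' v₂ * η x ![v₀, v₁] := by
  have hd : ∀ w : Fin 2 → W, ∀ b : W, fderiv ℝ (fun y => (a y • η y) w) x b
      = a x * fderiv ℝ (fun y => η y w) x b + a' b * η x w := by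
    intro w b
    have h1 : DifferentiableAt ℝ (fun y => η y w) x := by
      exact (hη.hasFDerivAt.continuousAlternatingMap_apply_const w).differentiableAt
    have h2 : HasFDerivAt (fun y => (a y • η y) w) _ x := ha.mul h1.hasFDerivAt
    rw [h2.fderiv]
    simp
    ring
  have h0 : extDeriv η x ![v₀, v₁, v₂] = 0 := by rw [hcl]; rfl
  rw [extDeriv_apply hη, Fin.sum_univ_three] at h0
  rw [extDeriv_apply (ha.differentiableAt.fun_smul hη), Fin.sum_univ_three]
  simp only [hd]
  have e0 : (0 : Fin 3).removeNth ![v₀, v₁, v₂] = ![v₁, v₂] := by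
    ext i; fin_cases i <;> rfl
  have e1 : (1 : Fin 3).removeNth ![v₀, v₁, v₂] = ![v₀, v₂] := by
    ext i; fin_cases i <;> rfl
  have e2 : (2 : Fin 3).removeNth ![v₀, v₁, v₂] = ![v₀, v₁] := by
    ext i; fin_cases i <;> rfl
  simp [e0, e1, e2] at h0 ⊢
  -- By the Leibniz rule the remaining terms add up to `a · dη`, which vanishes.
  linear_combination a x * h0

variable {V : Type*} [NormedAddCommGroup V] [InnerProductSpace ℂ V] {l : HopfParameter}
  {M : Type*} [TopologicalSpace M] [ChartedSpace E M]

/-- The Lee form is `- d log ‖f‖²` for every continuous local lift `f`. -/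
theorem lee_eq_differential [FiniteDimensional ℂ E] (hdim : 2 ≤ Module.finrank ℂ E)
    [IsManifold 𝓘(ℂ, E) ω M] {Ω : DiffForm E M 2} {θ : DiffForm E M 1} (hΩ : IsLCK Ω θ)
    {F : M → HopfManifold V l} (hF : IsLCKImmersion Ω F) {f : M → V} {x : M}
    (hf : ContinuousAt f x) (h : ∀ᶠ x' in 𝓝 x, IsHopfLift (f x') (F x')) :
    θ x = differential E (fun x' => -Real.log (‖f x'‖ ^ 2)) x := by
  let _ : InnerProductSpace ℝ V := InnerProductSpace.complexToReal
  set φ := chartAt E x with hφ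
  set p := φ x with hp
  have hpt : p ∈ φ.target := mem_chart_target E x
  have hxs : φ.symm p = x := φ.left_inv (mem_chart_source E x)
  have hfa := contMDiffAt_of_isHopfLift (hF.holomorphic x) hf h
  set g : E → V := f ∘ φ.symm with hg
  have hga : ContMDiffAt 𝓘(ℂ, E) 𝓘(ℂ, V) ω g p := by
    refine ContMDiffAt.comp p (by rwa [hxs]) ?_
    exact (contMDiffOn_chart_symm (n := ω) (I := 𝓘(ℂ, E)) (x := x)).contMDiffAt
      ((chartAt E x).open_target.mem_nhds hpt)
  have hgc : ContDiffAt ℝ ω g p := hga.contDiffAt.restrict_scalars ℝ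
  have hgl : ∀ᶠ q in 𝓝 p, IsHopfLift (g q) (F (φ.symm q)) :=
      (φ.continuousAt_symm hpt).eventually
      (p := fun x' => IsHopfLift (f x') (F x')) (by rwa [hxs])
  let η : E → E [⋀^Fin 2]→L[ℝ] ℝ := fun q => (flatForm V).compContinuousLinearMap (fderiv ℝ g q)
  have hη : DifferentiableAt ℝ η p :=
    (differentiableAt_const _).continuousAlternatingMapCompContinuousLinearMap
      ((hgc.fderiv_right (m := 1) (by simp)).differentiableAt (by simp))
  -- `η` is the pullback of a constant form, hence closed.
  have hηcl : extDeriv η p = 0 := by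
    have hc : DifferentiableAt ℝ (fun _ : V => flatForm V) (g p) := differentiableAt_const _
    have := extDeriv_pullback hc hgc (by simp)
    rw [extDeriv_const] at this
    exact this
  have hev : DiffForm.pullback (E := E) (E' := E) (φ.symm : E → M) Ω
      =ᶠ[𝓝 p] fun q => (‖g q‖ ^ 2)⁻¹ • η q := by
    have h1 : ∀ᶠ q in 𝓝 p, ContMDiffAt 𝓘(ℂ, E) 𝓘(ℂ, V) ω g q :=
      contMDiffAt_iff_contMDiffAt_nhds (by simp) |>.1 hga
    filter_upwards [h1, hgl.eventually_nhds, φ.open_target.mem_nhds hpt] with q hq hql hqt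
    have hsm : ContMDiffAt 𝓘(ℂ, E) 𝓘(ℂ, E) ω φ.symm q :=
      (contMDiffOn_chart_symm (n := ω) (I := 𝓘(ℂ, E)) (x := x)).contMDiffAt
        ((chartAt E x).open_target.mem_nhds hqt)
    have hFq := hF.holomorphic (φ.symm q)
    rw [← hF.pullback_eq, DiffForm.pullback_pullback _
      (hFq.mdifferentiableAt (by simp)).restrictScalars_real
      (hsm.mdifferentiableAt (by simp)).restrictScalars_real,
      pullback_hopfForm_eq (g := g) (hFq.comp q hsm) hq.continuousAt hql, DiffForm.pullback,
      mfderiv_eq_fderiv]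
  have hgp : g p = f x := by simp [hg, hxs]
  have hfx : ‖f x‖ ^ 2 ≠ 0 := by
    have := norm_pos_iff.2 h.self_of_nhds.ne_zero
    positivity
  have hn : HasFDerivAt (fun q => ‖g q‖ ^ 2) (fderiv ℝ (fun q => ‖g q‖ ^ 2) p) p :=
    ((hgc.differentiableAt (by simp)).norm_sq ℝ).hasFDerivAt
  set N' := fderiv ℝ (fun q => ‖g q‖ ^ 2) p with hN'
  have ha : HasFDerivAt (fun q => (‖g q‖ ^ 2)⁻¹) (-((‖f x‖ ^ 2) ^ 2)⁻¹ • N') p := by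
    have := (hasDerivAt_inv (x := ‖g p‖ ^ 2) (by rwa [hgp])).comp_hasFDerivAt p hn
    rwa [hgp] at this
  have hlog : HasFDerivAt (fun q => -Real.log (‖g q‖ ^ 2)) (-((‖f x‖ ^ 2)⁻¹ • N')) p := by
    have := (hn.log (by rwa [hgp])).neg
    rwa [hgp] at this
  have hd0 : mfderiv 𝓘(ℝ, E) 𝓘(ℝ, ℝ) (fun x' => -Real.log (‖f x'‖ ^ 2)) x
      = (-((‖f x‖ ^ 2)⁻¹ • N') : E →L[ℝ] ℝ) := by
    refine HasMFDerivAt.mfderiv ⟨?_, ?_⟩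
    · refine ContinuousAt.neg (ContinuousAt.log (hf.norm.pow 2) hfx)
    · simp only [writtenInExtChartAt, extChartAt, mfld_simps]
      exact hlog.hasFDerivWithinAt
  have hΩx : Ω x = (‖f x‖ ^ 2)⁻¹ • η p := by
    rw [← hgp]
    exact (DiffForm.pullback_chartAt_symm_self Ω x).symm.trans hev.self_of_nhds
  set τ : E →L[ℝ] ℝ := (ContinuousAlternatingMap.ofSubsingleton ℝ E ℝ (0 : Fin 1)).symm (θ x)
    with hτ
  have hθ : ∀ v, θ x ![v] = τ v := fun v => by
    rw [hτ]
    change θ x ![v] = θ x (fun _ => v)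
    congr 1
    ext i; fin_cases i; rfl
  -- With `Ω = ‖g‖⁻² η` and `η` closed, `dΩ = -‖f‖⁻² N' ∧ Ω`; comparison with `dΩ = θ ∧ Ω` gives a
  -- 1-form whose wedge with `Ω` is zero.
  have hzero : τ + (‖f x‖ ^ 2)⁻¹ • N' = 0 := by
    refine eq_zero_of_wedge_eq_zero hdim _ (fun v w => Ω x ![v, w])
      (fun w hw => (hΩ.pos x w hw).ne') fun v₀ v₁ v₂ => ?_
    have h1 := hΩ.d_form x v₀ v₁ v₂
    rw [DiffForm.d, hev.extDeriv_eq, extDeriv_smul_of_closed ha hη hηcl] at h1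
    simp only [hθ, hΩx, ContinuousAlternatingMap.smul_apply, smul_eq_mul,
      add_apply, smul_apply] at h1 ⊢
    field_simp at h1 ⊢
    linear_combination -h1
  have hτ' : τ = -((‖f x‖ ^ 2)⁻¹ • N') := eq_neg_of_add_eq_zero_left hzero
  rw [differential, hd0, ← hτ', hτ]
  exact (Equiv.apply_symm_apply _ _).symm

theorem eventually_eq_of_mfderiv_eq_zero [IsManifold 𝓘(ℂ, E) ω M] {f : M → ℝ} {x : M}
    (h : ∀ᶠ y in 𝓝 x, MDifferentiableAt 𝓘(ℝ, E) 𝓘(ℝ, ℝ) f y ∧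
      mfderiv 𝓘(ℝ, E) 𝓘(ℝ, ℝ) f y = (0 : E →L[ℝ] ℝ)) :
    ∀ᶠ y in 𝓝 x, f y = f x := by
  set φ := chartAt E x with hφ
  have hpt : φ x ∈ φ.target := mem_chart_target E x
  have hxs : φ.symm (φ x) = x := φ.left_inv (mem_chart_source E x)
  have h1 : ∀ᶠ q in 𝓝 (φ x), DifferentiableAt ℝ (f ∘ φ.symm) q ∧ fderiv ℝ (f ∘ φ.symm) q = 0 := by
    have h2 : ∀ᶠ q in 𝓝 (φ x), MDifferentiableAt 𝓘(ℝ, E) 𝓘(ℝ, ℝ) f (φ.symm q) ∧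
        mfderiv 𝓘(ℝ, E) 𝓘(ℝ, ℝ) f (φ.symm q) = (0 : E →L[ℝ] ℝ) :=
      (φ.continuousAt_symm hpt).eventually
      (p := fun y => MDifferentiableAt 𝓘(ℝ, E) 𝓘(ℝ, ℝ) f y ∧
        mfderiv 𝓘(ℝ, E) 𝓘(ℝ, ℝ) f y = (0 : E →L[ℝ] ℝ)) (by rwa [hxs])
    filter_upwards [h2, φ.open_target.mem_nhds hpt] with q hq hqt
    have hs := (mdifferentiableAt_chartAt_symm (M := M) x hqt).restrictScalars_real
    refine ⟨(hq.1.comp q hs).differentiableAt, ?_⟩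
    rw [← mfderiv_eq_fderiv, mfderiv_comp q hq.1 hs, hq.2]
    exact ContinuousLinearMap.zero_comp _
  obtain ⟨r, hr, hball⟩ := Metric.eventually_nhds_iff_ball.1 h1
  have h3 : ∀ᶠ q in 𝓝 (φ x), f (φ.symm q) = f x := by
    filter_upwards [Metric.ball_mem_nhds _ hr] with q hq
    have := Metric.isOpen_ball.is_const_of_fderiv_eq_zero (𝕜 := ℝ)
      (convex_ball (φ x) r).isPreconnected
      (fun q hq => (hball q hq).1.differentiableWithinAt) (fun q hq => (hball q hq).2)
      hq (Metric.mem_ball_self hr)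
    simpa [hxs] using this
  filter_upwards [(φ.continuousAt (mem_chart_source E x)).eventually h3,
    φ.open_source.mem_nhds (mem_chart_source E x)] with y hy hys
  rwa [φ.left_inv hys] at hy

end Lee

/-! ### The Lee form on a space over `M`, and the maximum principle for lifts. -/

section LeePullback

variable {V : Type*} [NormedAddCommGroup V] [InnerProductSpace ℂ V] {l : HopfParameter}
  {E : Type*} [NormedAddCommGroup E] [NormedSpace ℂ E]
  {M : Type*} [TopologicalSpace M] [ChartedSpace E M]
  {E' : Type*} [NormedAddCommGroup E'] [NormedSpace ℂ E']
  {N : Type*} [TopologicalSpace N] [ChartedSpace E' N]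

theorem contMDiffAt_neg_log_norm_sq {f : M → V} {x : M}
    (hf : ContMDiffAt 𝓘(ℂ, E) 𝓘(ℂ, V) ω f x) (h0 : f x ≠ 0) :
    ContMDiffAt 𝓘(ℝ, E) 𝓘(ℝ, ℝ) ∞ (fun x => -Real.log (‖f x‖ ^ 2)) x := by
  let _ : InnerProductSpace ℝ V := InnerProductSpace.complexToReal
  have h1 : ContDiffAt ℝ ∞ (fun z : V => -Real.log (‖z‖ ^ 2)) (f x) :=
    ((contDiff_norm_sq ℝ).contDiffAt.log (pow_ne_zero 2 (norm_ne_zero_iff.2 h0))).neg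
  exact h1.contMDiffAt.comp x (hf.restrictScalars_real.of_le le_top)

/-- Charts of the Hopf manifold are local sections of the quotient map; scaling one by a power of
`l` makes it pass through `z`. -/
theorem exists_local_lift {G : N → HopfManifold V l} {y : N} (hG : ContinuousAt G y) {z : V}
    (hz : IsHopfLift z (G y)) :
    ∃ g : N → V, ContinuousAt g y ∧ (∀ᶠ x in 𝓝 y, IsHopfLift (g x) (G x)) ∧ g y = z := by
  obtain ⟨k, hk⟩ := (isHopfLift_chartAt (mem_chart_source V (G y))).exists_zpow hz
  refine ⟨fun x => l.val ^ k • chartAt V (G y) (G x), ?_, ?_, hk.symm⟩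
  · exact (((chartAt V (G y)).continuousAt (mem_chart_source V _)).comp_of_eq hG rfl).const_smul _
  · filter_upwards [hG.eventually ((chartAt V (G y)).open_source.mem_nhds (mem_chart_source V _))]
      with x hx
    exact (isHopfLift_chartAt hx).zpow_smul k

/-- Near `y` the lift `g` of `F ∘ π` equals `f ∘ π` for a local lift `f` of `F` on `M`, so the
formula for `θ` can be pulled back. -/
theorem pullback_lee_eq_differential [FiniteDimensional ℂ E] (hdim : 2 ≤ Module.finrank ℂ E)
    [IsManifold 𝓘(ℂ, E) ω M] {Ω : DiffForm E M 2} {θ : DiffForm E M 1} (hΩ : IsLCK Ω θ)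
    {F : M → HopfManifold V l} (hF : IsLCKImmersion Ω F) {π : N → M} {g : N → V} {y : N}
    (hπ : ContMDiffAt 𝓘(ℂ, E') 𝓘(ℂ, E) ω π y)
    (hg : ContinuousAt g y) (h : ∀ᶠ x in 𝓝 y, IsHopfLift (g x) (F (π x))) :
    DiffForm.pullback (E := E) (E' := E') π θ y
      = differential E' (fun x => -Real.log (‖g x‖ ^ 2)) y := by
  have hFc := hF.holomorphic.continuous
  obtain ⟨k, hk⟩ := eventually_eq_zpow_smul_chartAt (G := fun x => F (π x))
    (hFc.continuousAt.comp hπ.continuousAt) hg h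
  set f : M → V := fun x => l.val ^ k • chartAt V (F (π y)) (F x) with hf
  have hfc : ContinuousAt f (π y) :=
    (((chartAt V (F (π y))).continuousAt (mem_chart_source V _)).comp_of_eq
      hFc.continuousAt rfl).const_smul _
  have hfl : ∀ᶠ x in 𝓝 (π y), IsHopfLift (f x) (F x) := by
    filter_upwards [hFc.continuousAt.eventually
      ((chartAt V (F (π y))).open_source.mem_nhds (mem_chart_source V _))] with x hx
    exact (isHopfLift_chartAt hx).zpow_smul k
  have hfa := contMDiffAt_of_isHopfLift (hF.holomorphic (π y)) hfc hfl
  have h1 := lee_eq_differential hdim hΩ hF hfc hfl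
  have h2 : DiffForm.pullback (E := E) (E' := E') π θ y = DiffForm.pullback (E := E) (E' := E') π
      (differential E (fun x => -Real.log (‖f x‖ ^ 2))) y := by
    simp only [DiffForm.pullback, h1]
  rw [h2, differential_pullback
    ((contMDiffAt_neg_log_norm_sq hfa hfl.self_of_nhds.ne_zero).mdifferentiableAt (by simp))
    (hπ.mdifferentiableAt (by simp)).restrictScalars_real, differential_eq_iff]
  refine Filter.EventuallyEq.mfderiv_eq ?_
  filter_upwards [hk] with x hx
  simp only [Function.comp_apply, hf, hx]

/-- An inner product space is strictly convex, so a holomorphic map whose norm has a local maximum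
is locally constant. Its derivative then vanishes, so `Ω x = 0`, against positivity. -/
theorem not_isLocalMax_norm_lift [Nontrivial E] [IsManifold 𝓘(ℂ, E) ω M]
    {Ω : DiffForm E M 2} {θ : DiffForm E M 1} (hΩ : IsLCK Ω θ)
    {F : M → HopfManifold V l} (hF : IsLCKImmersion Ω F) {f : M → V} {x : M}
    (hf : ContinuousAt f x) (h : ∀ᶠ x' in 𝓝 x, IsHopfLift (f x') (F x')) :
    ¬ IsLocalMax (fun x' => ‖f x'‖) x := by
  intro hmax
  let _ : InnerProductSpace ℝ V := InnerProductSpace.complexToReal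
  set φ := chartAt E x with hφ
  have hpt : φ x ∈ φ.target := mem_chart_target E x
  have hxs : φ.symm (φ x) = x := φ.left_inv (mem_chart_source E x)
  have hfa := contMDiffAt_of_isHopfLift (hF.holomorphic x) hf h
  have hga : ContMDiffAt 𝓘(ℂ, E) 𝓘(ℂ, V) ω (f ∘ φ.symm) (φ x) := by
    refine ContMDiffAt.comp (φ x) (by rwa [hxs]) ?_
    exact (contMDiffOn_chart_symm (n := ω) (I := 𝓘(ℂ, E)) (x := x)).contMDiffAt
      ((chartAt E x).open_target.mem_nhds hpt)
  have hgd : ∀ᶠ q in 𝓝 (φ x), DifferentiableAt ℂ (f ∘ φ.symm) q :=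
    (contMDiffAt_iff_contMDiffAt_nhds (by simp) |>.1 hga).mono fun q hq =>
      (hq.mdifferentiableAt (by simp)).differentiableAt
  have hgm : IsLocalMax (norm ∘ (f ∘ φ.symm)) (φ x) := by
    have := (φ.continuousAt_symm hpt).eventually (p := fun x' => ‖f x'‖ ≤ ‖f x‖)
      (by rw [hxs]; exact hmax)
    filter_upwards [this] with q hq
    simpa [hxs] using hq
  have hconst := Complex.eventually_eq_of_isLocalMax_norm hgd hgm
  have hfconst : f =ᶠ[𝓝 x] fun _ => f x := by
    filter_upwards [(φ.continuousAt (mem_chart_source E x)).eventually hconst,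
      φ.open_source.mem_nhds (mem_chart_source E x)] with y hy hys
    simpa [φ.left_inv hys, hxs] using hy
  have hΩx : Ω x = (‖f x‖ ^ 2)⁻¹ • DiffForm.pullback (E := V) (E' := E) f (fun _ => flatForm V) x := by
    rw [← pullback_hopfForm_eq (hF.holomorphic x) hf h, hF.pullback_eq]
  obtain ⟨v, hv⟩ := exists_ne (0 : E)
  refine (hΩ.pos x v hv).ne' ?_
  rw [hΩx, DiffForm.pullback, hfconst.mfderiv_eq, mfderiv_const]
  have key : ((flatForm V).compContinuousLinearMap (0 : E →L[ℝ] V)) ![v, Complex.I • v] = 0 := by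
    rw [ContinuousAlternatingMap.compContinuousLinearMap_apply, flatForm_apply]
    simp
  rw [ContinuousAlternatingMap.smul_apply]
  exact smul_eq_zero_of_right _ key

theorem pullback_flatForm_const_smul {f : N → V} {y : N}
    (hf : MDifferentiableAt 𝓘(ℂ, E') 𝓘(ℂ, V) f y) (a : ℂ) :
    DiffForm.pullback (E := V) (E' := E') (fun x => a • f x) (fun _ => flatForm V) y
      = ‖a‖ ^ 2 • DiffForm.pullback (E := V) (E' := E') f (fun _ => flatForm V) y := by
  have h1 : mfderiv 𝓘(ℝ, E') 𝓘(ℝ, V) (fun x => a • f x) y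
      = (a • (mfderiv 𝓘(ℂ, E') 𝓘(ℂ, V) f y : E' →L[ℂ] V)).restrictScalars ℝ :=
    (HasMFDerivAt.restrictScalars_real (hf.hasMFDerivAt.const_smul a)).mfderiv
  rw [DiffForm.pullback, DiffForm.pullback, h1, hf.mfderiv_real_eq]
  ext v
  have key : ∀ L : E' →L[ℂ] V, (flatForm V).compContinuousLinearMap ((a • L).restrictScalars ℝ) v
      = ‖a‖ ^ 2 * (flatForm V).compContinuousLinearMap (L.restrictScalars ℝ) v :=
    fun L => flatForm_smul a fun i => L (v i)
  exact key _

end LeePullback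

/-! ### Injectivity of the Hopf character and the rank of its images. -/

section Hopf

variable {l : HopfParameter}

theorem coe_hopfCharacter (k : Multiplicative ℤ) :
    (hopfCharacter l k : ℝ) = ‖l.val ^ k.toAdd‖ ^ 2 := by
  simp only [hopfCharacter, zpowersHom_apply, Positive.coe_zpow, norm_zpow]
  rw [← zpow_natCast, ← zpow_natCast, ← zpow_mul, ← zpow_mul, mul_comm]

theorem hopfCharacter_injective : Function.Injective (hopfCharacter l) := by
  rw [injective_iff_map_eq_one]
  intro k hk
  have h1 : ‖l.val ^ k.toAdd‖ ^ 2 = 1 := by rw [← coe_hopfCharacter, hk]; rfl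
  have h2 : ‖l.val‖ ^ k.toAdd = 1 := by
    rw [norm_zpow] at h1
    exact (pow_eq_one_iff_of_nonneg (zpow_pos l.norm_pos _).le two_ne_zero).1 h1
  exact HopfParameter.norm_zpow_eq_one h2

theorem HopfParameter.log_norm_ne_zero (l : HopfParameter) : Real.log ‖l.val‖ ≠ 0 :=
  Real.log_ne_zero_of_pos_of_ne_one l.norm_pos l.norm_ne_one

/-- The range is cyclic as an image of a subgroup of `ℤ`, and infinite because the Hopf character is
injective and `κ g` has infinite order. -/
theorem rank_range_hopfCharacter_comp {G : Type*} [Group G] (κ : G →* Multiplicative ℤ)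
    (hκ : ∃ g, κ g ≠ 1) : Module.rank ℤ (Additive ((hopfCharacter l).comp κ).range) = 1 := by
  obtain ⟨g, hg⟩ := hκ
  have hcyc : IsCyclic ((hopfCharacter l).comp κ).range := by
    have : IsCyclic κ.range := inferInstance
    rw [MonoidHom.range_comp]
    exact isCyclic_of_surjective ((hopfCharacter l).subgroupMap κ.range)
      ((hopfCharacter l).subgroupMap_surjective κ.range)
  have hinf : Infinite ((hopfCharacter l).comp κ).range := by
    refine Infinite.of_injective (fun n : ℤ => (⟨_, ⟨g ^ n, rfl⟩⟩ :
      ((hopfCharacter l).comp κ).range)) fun m n hmn => ?_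
    have h1 : κ (g ^ m) = κ (g ^ n) := hopfCharacter_injective (Subtype.ext_iff.1 hmn)
    rw [map_zpow, map_zpow] at h1
    have h2 : m * (κ g).toAdd = n * (κ g).toAdd := by
      simpa using congrArg Multiplicative.toAdd h1
    exact mul_right_cancel₀ (fun h => hg h) h2
  let e : Multiplicative ℤ ≃* ((hopfCharacter l).comp κ).range := intCyclicMulEquiv
  rw [← e.toAdditiveRight.toIntLinearEquiv.rank_eq]
  simp

end Hopf

/-! ### Lifts to Kähler coverings -/

namespace KahlerCovering

section Lift

variable {V : Type*} [NormedAddCommGroup V] [InnerProductSpace ℂ V] {l : HopfParameter}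
  {E : Type*} [NormedAddCommGroup E] [NormedSpace ℂ E]
  {M : Type*} [TopologicalSpace M] [ChartedSpace E M]
  {θ : DiffForm E M 1} (K : KahlerCovering.{w} θ)

theorem contMDiff_proj : ContMDiff 𝓘(ℂ, E) 𝓘(ℂ, E) ω K.proj := K.localDiffeo.contMDiff

variable {K} {Ω : DiffForm E M 2} {F : M → HopfManifold V l}

/-- Both `h` and `-log‖g‖²` are primitives of `π^*θ`. -/
theorem eventually_pot_add_log_eq [FiniteDimensional ℂ E] (hdim : 2 ≤ Module.finrank ℂ E)
    [IsManifold 𝓘(ℂ, E) ω M] (hΩ : IsLCK Ω θ) (hF : IsLCKImmersion Ω F)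
    {g : K.carrier → V} {y : K.carrier} (hg : ContinuousAt g y)
    (h : ∀ᶠ x in 𝓝 y, IsHopfLift (g x) (F (K.proj x))) :
    ∀ᶠ x in 𝓝 y, K.pot x + Real.log (‖g x‖ ^ 2) = K.pot y + Real.log (‖g y‖ ^ 2) := by
  have hga : ContMDiffAt 𝓘(ℂ, E) 𝓘(ℂ, V) ω g y :=
    contMDiffAt_of_isHopfLift (G := F ∘ K.proj) ((hF.holomorphic.comp K.contMDiff_proj) y) hg h
  have hev : ∀ᶠ x in 𝓝 y, ContMDiffAt 𝓘(ℂ, E) 𝓘(ℂ, V) ω g x :=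
    contMDiffAt_iff_contMDiffAt_nhds (by simp) |>.1 hga
  have key := eventually_eq_of_mfderiv_eq_zero (E := E)
    (f := K.pot - fun x => -Real.log (‖g x‖ ^ 2)) (x := y) (by
      filter_upwards [hev, h.eventually_nhds] with x hx hlx
      have h1 : MDifferentiableAt 𝓘(ℝ, E) 𝓘(ℝ, ℝ) K.pot x :=
        (K.smooth_pot x).mdifferentiableAt (by simp)
      have h2 : MDifferentiableAt 𝓘(ℝ, E) 𝓘(ℝ, ℝ) (fun x => -Real.log (‖g x‖ ^ 2)) x :=
        (contMDiffAt_neg_log_norm_sq hx hlx.self_of_nhds.ne_zero).mdifferentiableAt (by simp)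
      have h3 := pullback_lee_eq_differential hdim hΩ hF (K.contMDiff_proj x) hx.continuousAt hlx
      rw [K.d_pot, differential_eq_iff] at h3
      refine ⟨h1.sub h2, ?_⟩
      have h4 := (h1.hasMFDerivAt.sub h2.hasMFDerivAt).mfderiv
      rw [h4, h3]
      exact sub_self _)
  filter_upwards [key] with x hx
  simpa using hx

/-- Existence of the holomorphic lift: among the representatives of `F (π y)` there is exactly one
for which `h + log ‖z‖²` has a prescribed value. -/
theorem exists_isHolomorphicLift [FiniteDimensional ℂ E] (hdim : 2 ≤ Module.finrank ℂ E)
    [IsManifold 𝓘(ℂ, E) ω M] (hΩ : IsLCK Ω θ) (hF : IsLCKImmersion Ω F) :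
    ∃ (F' : K.carrier → V) (c : ℝ), K.IsHolomorphicLift F F' ∧ 0 < c ∧
      ∀ y, c * ‖F' y‖ ^ 2 = Real.exp (-K.pot y) := by
  have hFc : Continuous fun y => F (K.proj y) :=
    hF.holomorphic.continuous.comp K.contMDiff_proj.continuous
  obtain ⟨y₀⟩ : Nonempty K.carrier := inferInstance
  obtain ⟨z₀, hz₀⟩ := exists_isHopfLift (F (K.proj y₀))
  set c₀ := K.pot y₀ + Real.log (‖z₀‖ ^ 2) with hc₀
  have hlog : ∀ {z : V}, z ≠ 0 → ∀ k : ℤ,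
      Real.log (‖l.val ^ k • z‖ ^ 2) = Real.log (‖l.val ^ k‖ ^ 2) + Real.log (‖z‖ ^ 2) := by
    intro z hz k
    rw [norm_smul, mul_pow, Real.log_mul]
    · exact pow_ne_zero 2 (norm_ne_zero_iff.2 (zpow_ne_zero _ l.ne_zero))
    · exact pow_ne_zero 2 (norm_ne_zero_iff.2 hz)
  -- Solvability of the normalisation `h + log‖z‖² = c₀` at `y`. Along a local lift `h + log‖g‖²` is
  -- constant, so the same power of `l` solves it at nearby points; connectedness then carries it
  -- from `y₀` to all points.
  let S : K.carrier → Prop := fun y =>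
    ∃ z, IsHopfLift z (F (K.proj y)) ∧ K.pot y + Real.log (‖z‖ ^ 2) = c₀
  have hS : IsLocallyConstant S := by
    rw [IsLocallyConstant.iff_eventually_eq]
    intro y
    obtain ⟨z, hz⟩ := exists_isHopfLift (F (K.proj y))
    obtain ⟨g, hg, hgl, -⟩ := exists_local_lift hFc.continuousAt hz
    filter_upwards [eventually_pot_add_log_eq hdim hΩ hF hg hgl, hgl] with x hx hlx
    have hly := hgl.self_of_nhds
    refine propext ⟨?_, ?_⟩
    · rintro ⟨z', hz', hzc⟩
      obtain ⟨k, rfl⟩ := hlx.exists_zpow hz'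
      refine ⟨_, hly.zpow_smul k, ?_⟩
      rw [hlog hlx.ne_zero] at hzc
      rw [hlog hly.ne_zero]
      linarith
    · rintro ⟨z', hz', hzc⟩
      obtain ⟨k, rfl⟩ := hly.exists_zpow hz'
      refine ⟨_, hlx.zpow_smul k, ?_⟩
      rw [hlog hly.ne_zero] at hzc
      rw [hlog hlx.ne_zero]
      linarith
  have hSall : ∀ y, S y := fun y => by
    rw [hS.apply_eq_of_preconnectedSpace y y₀]
    exact ⟨z₀, hz₀, rfl⟩
  choose F' hF'l hF'c using hSall
  have hF'eq : ∀ {z : V} {y : K.carrier}, IsHopfLift z (F (K.proj y)) →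
      K.pot y + Real.log (‖z‖ ^ 2) = c₀ → F' y = z := by
    intro z y hz hzc
    refine (hF'l y).eq_of_norm_eq hz ?_
    have h1 : Real.log (‖F' y‖ ^ 2) = Real.log (‖z‖ ^ 2) := by linarith [hF'c y]
    have hp1 := norm_pos_iff.2 (hF'l y).ne_zero
    have hp2 := norm_pos_iff.2 hz.ne_zero
    have h2 := Real.log_injOn_pos (Set.mem_Ioi.2 (pow_pos hp1 2)) (Set.mem_Ioi.2 (pow_pos hp2 2)) h1
    exact (pow_left_inj₀ hp1.le hp2.le two_ne_zero).1 h2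
  -- The constant comes from `‖F'‖² = exp (c₀ - h)`. For holomorphy, `F'` agrees near `y` with the
  -- local lift through `F' y` by uniqueness, hence is continuous.
  refine ⟨F', Real.exp (-c₀), ⟨fun y => ?_, hF'l⟩, Real.exp_pos _, fun y => ?_⟩
  · obtain ⟨g, hg, hgl, hgy⟩ := exists_local_lift hFc.continuousAt (hF'l y)
    refine contMDiffAt_of_isHopfLift (G := F ∘ K.proj)
      ((hF.holomorphic.comp K.contMDiff_proj) y) (hg.congr ?_) (Filter.Eventually.of_forall hF'l)
    filter_upwards [eventually_pot_add_log_eq hdim hΩ hF hg hgl, hgl] with x hx hlx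
    exact (hF'eq hlx (by rw [hx, hgy, hF'c])).symm
  · have hp1 := pow_pos (norm_pos_iff.2 (hF'l y).ne_zero) 2
    rw [← Real.exp_log hp1, ← Real.exp_add]
    congr 1
    linarith [hF'c y]

end Lift

/-! ### The potential, the deck action, nontriviality of the character and properness. -/

section Conclusions

variable {V : Type*} [NormedAddCommGroup V] [InnerProductSpace ℂ V] {l : HopfParameter}
  {E : Type*} [NormedAddCommGroup E] [NormedSpace ℂ E]
  {M : Type*} [TopologicalSpace M] [ChartedSpace E M]
  {θ : DiffForm E M 1} {K : KahlerCovering.{w} θ} {Ω : DiffForm E M 2} {F : M → HopfManifold V l}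
  {F' : K.carrier → V}

theorem IsHolomorphicLift.pullback_eq_ddc [IsManifold 𝓘(ℂ, E) ω M]
    (hF' : K.IsHolomorphicLift F F') (hF : IsLCKImmersion Ω F) (y : K.carrier) :
    DiffForm.pullback (E := E) (E' := E) K.proj Ω y
      = (‖F' y‖ ^ 2)⁻¹ • ddc E (fun z => ‖F' z‖ ^ 2) y := by
  rw [ddc_norm_sq (hF'.holomorphic y), ← hF.pullback_eq, DiffForm.pullback_pullback _
    ((hF.holomorphic _).mdifferentiableAt (by simp)).restrictScalars_real
    ((K.contMDiff_proj y).mdifferentiableAt (by simp)).restrictScalars_real]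
  exact pullback_hopfForm_eq ((hF.holomorphic.comp K.contMDiff_proj) y)
    (hF'.holomorphic.continuous.continuousAt) (Filter.Eventually.of_forall hF'.lift)

/-- The constant is absorbed into the holomorphic map, as `c‖f‖² = ‖√c f‖²`. -/
theorem ddc_const_mul_norm_sq {f : K.carrier → V} (hf : ContMDiff 𝓘(ℂ, E) 𝓘(ℂ, V) ω f) {c : ℝ}
    (hc : 0 < c) (y : K.carrier) :
    ddc E (fun z => c * ‖f z‖ ^ 2) y = c • ddc E (fun z => ‖f z‖ ^ 2) y := by
  set a : ℂ := (Real.sqrt c : ℂ) with ha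
  have hac : ‖a‖ ^ 2 = c := by
    rw [ha, Complex.norm_real, Real.norm_eq_abs, sq_abs, Real.sq_sqrt hc.le]
  have h1 : (fun z => c * ‖f z‖ ^ 2) = fun z => ‖a • f z‖ ^ 2 := by
    ext z
    rw [norm_smul, mul_pow, hac]
  have h2 : ContMDiffAt 𝓘(ℂ, E) 𝓘(ℂ, V) ω (fun z => a • f z) y :=
    (a • ContinuousLinearMap.id ℂ V).contMDiff.contMDiffAt.comp y (hf y)
  rw [h1, ddc_norm_sq h2, ddc_norm_sq (hf y),
    pullback_flatForm_const_smul ((hf y).mdifferentiableAt (by simp)), hac]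

/-- Deck transformations are only given as homeomorphisms; near `y` one is `π` followed by the
holomorphic local inverse of `π` at `γ y`. -/
theorem contMDiffAt_deck (γ : K.Deck) (y : K.carrier) :
    ContMDiffAt 𝓘(ℂ, E) 𝓘(ℂ, E) ω (γ : K.carrier ≃ₜ K.carrier) y := by
  obtain ⟨Φ, hΦ, heq⟩ := K.localDiffeo ((γ : K.carrier ≃ₜ K.carrier) y)
  have hproj : ∀ x, K.proj ((γ : K.carrier ≃ₜ K.carrier) x) = K.proj x := γ.2
  have hy : K.proj y ∈ Φ.target := by
    rw [← hproj y, heq hΦ]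
    exact Φ.map_source hΦ
  have h1 : ContMDiffAt 𝓘(ℂ, E) 𝓘(ℂ, E) ω Φ.symm (K.proj y) :=
    Φ.symm.contMDiffOn.contMDiffAt (Φ.open_target.mem_nhds hy)
  refine (h1.comp y (K.contMDiff_proj y)).congr_of_eventuallyEq ?_
  filter_upwards [(γ : K.carrier ≃ₜ K.carrier).continuous.continuousAt.preimage_mem_nhds
    (Φ.open_source.mem_nhds hΦ)] with x hx
  have h2 : Φ.symm (Φ ((γ : K.carrier ≃ₜ K.carrier) x)) = (γ : K.carrier ≃ₜ K.carrier) x :=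
    Φ.left_inv hx
  rw [Function.comp_apply, ← hproj x, heq hx, h2]

/-- The action of the deck group on a holomorphic lift. -/
theorem IsHolomorphicLift.exists_monoidHom (hF' : K.IsHolomorphicLift F F') :
    ∃ κ : K.Deck →* Multiplicative ℤ, ∀ (γ : K.Deck) (y : K.carrier),
      F' ((γ : K.carrier ≃ₜ K.carrier) y) = l.val ^ (κ γ).toAdd • F' y := by
  have hl1 : ∀ (γ : K.Deck) (y : K.carrier),
      IsHopfLift (F' ((γ : K.carrier ≃ₜ K.carrier) y)) (F (K.proj y)) := fun γ y => by
    have := hF'.lift ((γ : K.carrier ≃ₜ K.carrier) y)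
    rwa [show K.proj ((γ : K.carrier ≃ₜ K.carrier) y) = K.proj y from γ.2 y] at this
  have hex : ∀ γ : K.Deck, ∃ k : ℤ, ∀ y,
      F' ((γ : K.carrier ≃ₜ K.carrier) y) = l.val ^ k • F' y := by
    intro γ
    choose k hk using fun y => (hF'.lift y).exists_zpow (hl1 γ y)
    -- `F'` and `F' ∘ γ` both lift `F ∘ π`, so they differ locally by a fixed power of `l`;
    -- connectedness makes the exponent global.
    have hk' : IsLocallyConstant k := by
      rw [IsLocallyConstant.iff_eventually_eq]
      intro y
      obtain ⟨m, hm⟩ := eventually_eq_zpow_smul (f := fun y => F (K.proj y)) (t := y)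
        hF'.holomorphic.continuous.continuousAt
        ((hF'.holomorphic.continuous.comp
          (γ : K.carrier ≃ₜ K.carrier).continuous).continuousAt)
        (Filter.Eventually.of_forall hF'.lift) (Filter.Eventually.of_forall (hl1 γ))
      have huniq : ∀ x, F' ((γ : K.carrier ≃ₜ K.carrier) x) = l.val ^ m • F' x → k x = m :=
        fun x hx => (hF'.lift x).zpow_unique (by rw [← hk, hx])
      filter_upwards [hm] with x hx
      rw [huniq x hx, huniq y hm.self_of_nhds]
    obtain ⟨y₀⟩ : Nonempty K.carrier := inferInstance
    refine ⟨k y₀, fun y => ?_⟩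
    rw [hk, hk'.apply_eq_of_preconnectedSpace y y₀]
  choose k hk using hex
  obtain ⟨y₀⟩ : Nonempty K.carrier := inferInstance
  refine ⟨MonoidHom.mk' (fun γ => Multiplicative.ofAdd (k γ)) fun γ δ => ?_, hk⟩
  have h1 : F' (((γ * δ : K.Deck) : K.carrier ≃ₜ K.carrier) y₀)
      = l.val ^ (k γ + k δ) • F' y₀ := by
    change F' ((γ : K.carrier ≃ₜ K.carrier) ((δ : K.carrier ≃ₜ K.carrier) y₀)) = _
    rw [hk, hk, smul_smul, zpow_add₀ l.ne_zero]
  rw [hk] at h1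
  exact congrArg Multiplicative.ofAdd ((hF'.lift y₀).zpow_unique (congrArg norm h1))

/-- Since `π ∘ γ = π`, the form `π^*Ω` is invariant and only the conformal factor changes. -/
theorem kahlerForm_pullback_deck (γ : K.Deck) {r : ℝ} {y : K.carrier}
    (hr : Real.exp (-K.pot ((γ : K.carrier ≃ₜ K.carrier) y)) = r * Real.exp (-K.pot y))
    [IsManifold 𝓘(ℂ, E) ω M] :
    DiffForm.pullback (E := E) (E' := E) (γ : K.carrier ≃ₜ K.carrier) (K.kahlerForm Ω) y
      = r • K.kahlerForm Ω y := by
  have h1 : DiffForm.pullback (E := E) (E' := E) (γ : K.carrier ≃ₜ K.carrier)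
      (DiffForm.pullback (E := E) (E' := E) K.proj Ω) y
      = DiffForm.pullback (E := E) (E' := E) K.proj Ω y := by
    rw [DiffForm.pullback_pullback _
      ((K.contMDiff_proj _).mdifferentiableAt (by simp)).restrictScalars_real
      ((contMDiffAt_deck γ y).mdifferentiableAt (by simp)).restrictScalars_real]
    congr 1
    exact funext γ.2
  have h2 : DiffForm.pullback (E := E) (E' := E) (γ : K.carrier ≃ₜ K.carrier) (K.kahlerForm Ω) y
      = Real.exp (-K.pot ((γ : K.carrier ≃ₜ K.carrier) y)) •
        DiffForm.pullback (E := E) (E' := E) (γ : K.carrier ≃ₜ K.carrier)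
          (DiffForm.pullback (E := E) (E' := E) K.proj Ω) y := rfl
  rw [h2, h1, hr, kahlerForm, smul_smul]

/-- The images of finitely many compact neighbourhoods cover `M`, and the Galois property moves each
point into their union. -/
theorem exists_compact_surjOn [FiniteDimensional ℂ E] [CompactSpace M] (K : KahlerCovering.{w} θ) :
    ∃ C : Set K.carrier, IsCompact C ∧ ∀ y, ∃ z ∈ C, ∃ γ : K.Deck,
      (γ : K.carrier ≃ₜ K.carrier) z = y := by
  have : ProperSpace E := FiniteDimensional.proper ℂ E
  have : LocallyCompactSpace K.carrier := ChartedSpace.locallyCompactSpace E K.carrier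
  choose s hs using K.surjective
  choose D hDc hD using fun x => exists_compact_mem_nhds (s x)
  have hnhds : ∀ x, K.proj '' D x ∈ 𝓝 x := fun x => by
    have := K.covering.isLocalHomeomorph.map_nhds_eq (s x)
    rw [hs] at this
    rw [← this]
    exact Filter.image_mem_map (hD x)
  obtain ⟨t, ht⟩ := CompactSpace.elim_nhds_subcover _ hnhds
  refine ⟨⋃ x ∈ t, D x, t.isCompact_biUnion fun x _ => hDc x, fun y => ?_⟩
  have : K.proj y ∈ ⋃ x ∈ t, K.proj '' D x := by rw [ht]; trivial
  simp only [Set.mem_iUnion] at this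
  obtain ⟨x, hx, z, hz, hzy⟩ := this
  obtain ⟨γ, hγ, hγz⟩ := K.galois z y hzy
  exact ⟨z, by simp only [Set.mem_iUnion]; exact ⟨x, hx, hz⟩, ⟨γ, hγ⟩, hγz⟩

theorem IsHolomorphicLift.exists_deck_ne_one [FiniteDimensional ℂ E] [Nontrivial E]
    [IsManifold 𝓘(ℂ, E) ω M] [CompactSpace M] (hF' : K.IsHolomorphicLift F F')
    (hΩ : IsLCK Ω θ) (hF : IsLCKImmersion Ω F) {κ : K.Deck →* Multiplicative ℤ}
    (hκ : ∀ (γ : K.Deck) (y : K.carrier),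
      F' ((γ : K.carrier ≃ₜ K.carrier) y) = l.val ^ (κ γ).toAdd • F' y) : ∃ γ, κ γ ≠ 1 := by
  by_contra! hall
  obtain ⟨C, hC, hCs⟩ := K.exists_compact_surjOn
  obtain ⟨y⟩ : Nonempty K.carrier := inferInstance
  obtain ⟨z, hz, -⟩ := hCs y
  obtain ⟨y₀, -, hmax⟩ := hC.exists_isMaxOn ⟨z, hz⟩
    hF'.holomorphic.continuous.norm.continuousOn
  -- Under the contrary assumption `F'` is deck invariant, so its maximum on `C` is global.
  have hglob : ∀ y, ‖F' y‖ ≤ ‖F' y₀‖ := fun y => by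
    obtain ⟨z, hz, γ, rfl⟩ := hCs y
    rw [hκ, hall]
    simpa using hmax hz
  have hFc := hF.holomorphic.continuous
  obtain ⟨f, hf, hfl, hfy⟩ := exists_local_lift hFc.continuousAt (hF'.lift y₀)
  refine not_isLocalMax_norm_lift hΩ hF hf hfl ?_
  -- The maximum is transferred to a local lift on `M`: upstairs it differs from `F'` by a constant
  -- factor, and `π` is a local homeomorphism.
  obtain ⟨k, hk⟩ := eventually_eq_zpow_smul (f := fun y => F (K.proj y)) (t := y₀)
    hF'.holomorphic.continuous.continuousAt
    (ContinuousAt.comp (g := f) hf K.contMDiff_proj.continuous.continuousAt)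
    (Filter.Eventually.of_forall hF'.lift)
    (K.contMDiff_proj.continuous.continuousAt.eventually hfl)
  have hev : ∀ᶠ y in 𝓝 y₀, ‖f (K.proj y)‖ ≤ ‖f (K.proj y₀)‖ := by
    filter_upwards [hk] with y hy
    have h1 : f (K.proj y) = _ := hy
    have h2 : f (K.proj y₀) = _ := hk.self_of_nhds
    rw [h1, h2, norm_smul, norm_smul]
    exact mul_le_mul_of_nonneg_left (hglob y) (norm_nonneg _)
  have hmap := K.covering.isLocalHomeomorph.map_nhds_eq y₀
  rw [IsLocalMax, IsMaxFilter, ← hmap]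
  exact hev

/-- A deck transformation shifts `h` by `-2 κ(γ) log|l|`. Over a compact range of values `κ(γ)` is
thus bounded on the translates of `C` that occur, and injectivity leaves finitely many of them. -/
theorem isProperPotential_exp_neg_pot [FiniteDimensional ℂ E] [CompactSpace M]
    {c : ℝ} (hpot : ∀ y, c * ‖F' y‖ ^ 2 = Real.exp (-K.pot y)) {κ : K.Deck →* Multiplicative ℤ}
    (hκ : ∀ (γ : K.Deck) (y : K.carrier),
      F' ((γ : K.carrier ≃ₜ K.carrier) y) = l.val ^ (κ γ).toAdd • F' y)
    (hinj : Function.Injective κ) : K.IsProperPotential (fun y => Real.exp (-K.pot y)) := by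
  refine ⟨fun y => Real.exp_pos _, ?_⟩
  have hcont : Continuous fun y => (⟨Real.exp (-K.pot y), Real.exp_pos _⟩ : {r : ℝ // 0 < r}) :=
    (Real.continuous_exp.comp K.smooth_pot.continuous.neg).subtype_mk _
  have : LocallyCompactSpace {r : ℝ // 0 < r} := (isOpen_Ioi (a := (0 : ℝ))).locallyCompactSpace
  rw [isProperMap_iff_isCompact_preimage]
  refine ⟨hcont, fun Q hQ => ?_⟩
  obtain ⟨C, hC, hCs⟩ := K.exists_compact_surjOn
  obtain ⟨B₁, hB₁⟩ := hC.exists_bound_of_continuousOn K.smooth_pot.continuous.continuousOn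
  have hlogc : Continuous fun r : {r : ℝ // 0 < r} => Real.log r :=
    Continuous.log continuous_subtype_val fun r => r.2.ne'
  obtain ⟨B₂, hB₂⟩ := hQ.exists_bound_of_continuousOn hlogc.continuousOn
  have hpotγ : ∀ (γ : K.Deck) (y : K.carrier), K.pot ((γ : K.carrier ≃ₜ K.carrier) y)
      = K.pot y - (κ γ).toAdd * (2 * Real.log ‖l.val‖) := by
    intro γ y
    have hlk : 0 < ‖l.val‖ ^ (κ γ).toAdd := zpow_pos l.norm_pos _
    have h1 : Real.exp (-K.pot ((γ : K.carrier ≃ₜ K.carrier) y))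
        = Real.exp ((κ γ).toAdd * (2 * Real.log ‖l.val‖) + -K.pot y) := by
      rw [Real.exp_add, ← hpot, ← hpot, hκ, norm_smul, norm_zpow, mul_pow]
      have h2 : Real.exp ((κ γ).toAdd * (2 * Real.log ‖l.val‖))
          = (‖l.val‖ ^ (κ γ).toAdd) ^ 2 := by
        rw [← Real.exp_log (pow_pos hlk 2), Real.log_pow, Real.log_zpow]
        congr 1
        push_cast
        ring
      rw [h2]
      ring
    have := Real.exp_injective h1
    linarith
  -- `B₁` bounds `|h|` on `C` and `B₂` bounds it on the preimage of `Q`; if `z ∈ C` and `γ z` lies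
  -- in that preimage, then `|2 κ(γ) log‖l‖| ≤ B₁ + B₂`.
  set B := (B₁ + B₂) / |2 * Real.log ‖l.val‖| with hB
  have hL : 0 < |2 * Real.log ‖l.val‖| :=
    abs_pos.2 (mul_ne_zero two_ne_zero l.log_norm_ne_zero)
  have hfin : {γ : K.Deck | |(((κ γ).toAdd : ℤ) : ℝ)| ≤ B}.Finite := by
    refine Set.Finite.preimage (f := fun γ => (κ γ).toAdd)
      (s := {k : ℤ | |(k : ℝ)| ≤ B}) (fun a _ b _ h => hinj (Multiplicative.toAdd.injective h)) ?_
    refine (Set.finite_Icc (-⌈B⌉) ⌈B⌉).subset fun k hk => ?_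
    have := abs_le.1 (show |(k : ℝ)| ≤ B from hk)
    have h3 := Int.le_ceil B
    constructor
    · have : (((-⌈B⌉ : ℤ)) : ℝ) ≤ (k : ℝ) := by push_cast; linarith
      exact_mod_cast this
    · have : (k : ℝ) ≤ (⌈B⌉ : ℝ) := by linarith
      exact_mod_cast this
  refine (hfin.isCompact_biUnion fun γ _ =>
    hC.image (γ : K.carrier ≃ₜ K.carrier).continuous).of_isClosed_subset
    (hQ.isClosed.preimage hcont) fun y hy => ?_
  obtain ⟨z, hz, γ, rfl⟩ := hCs y
  simp only [Set.mem_iUnion]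
  refine ⟨γ, ?_, z, hz, rfl⟩
  have h1 := hB₁ z hz
  have h2 := hB₂ _ hy
  simp only [Real.log_exp, norm_neg, Real.norm_eq_abs, hpotγ] at h1 h2
  rw [Set.mem_ofPred_eq, hB, le_div_iff₀ hL, ← abs_mul]
  have h3 := abs_sub_abs_le_abs_sub ((κ γ).toAdd * (2 * Real.log ‖l.val‖)) (K.pot z)
  rw [abs_sub_comm] at h3
  linarith

/-- All the properties of a holomorphic lift whose squared norm is, up to a constant, `exp (-h)`. -/
theorem IsHolomorphicLift.exists_character [FiniteDimensional ℂ E] [Nontrivial E]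
    [IsManifold 𝓘(ℂ, E) ω M] [CompactSpace M] (hF' : K.IsHolomorphicLift F F')
    (hΩ : IsLCK Ω θ) (hF : IsLCKImmersion Ω F) {c : ℝ} (hc : 0 < c)
    (hpot : ∀ y, c * ‖F' y‖ ^ 2 = Real.exp (-K.pot y)) :
    ∃ χ : K.Deck →* {r : ℝ // 0 < r}, K.IsHomothetyCharacter Ω χ ∧
      χ.range ≤ (hopfCharacter l).range ∧ lckRank χ = 1 ∧
      K.IsAutomorphicPotential Ω χ (fun y => c * ‖F' y‖ ^ 2) ∧
      (Function.Injective χ → K.IsProperPotential (fun y => c * ‖F' y‖ ^ 2)) ∧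
      ∀ (γ : K.Deck) y, χ γ = 1 → F' ((γ : K.carrier ≃ₜ K.carrier) y) = F' y := by
  obtain ⟨κ, hκ⟩ := hF'.exists_monoidHom
  have hχ : ∀ (γ : K.Deck) y, ‖F' ((γ : K.carrier ≃ₜ K.carrier) y)‖ ^ 2
      = ((hopfCharacter l).comp κ γ : ℝ) * ‖F' y‖ ^ 2 := by
    intro γ y
    rw [hκ, norm_smul, mul_pow, MonoidHom.comp_apply, coe_hopfCharacter]
  refine ⟨(hopfCharacter l).comp κ, fun γ => ?_, ?_, ?_, ⟨?_, ?_, ?_, ?_⟩, ?_, ?_⟩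
  · ext1 y
    refine kahlerForm_pullback_deck γ ?_
    rw [← hpot, ← hpot, hχ]
    ring
  · rintro _ ⟨γ, rfl⟩
    exact ⟨κ γ, rfl⟩
  · exact rank_range_hopfCharacter_comp κ (hF'.exists_deck_ne_one hΩ hF hκ)
  · rw [funext hpot]
    exact Real.contDiff_exp.contMDiff.comp K.smooth_pot.neg
  · intro y
    have := pow_pos (norm_pos_iff.2 (hF'.lift y).ne_zero) 2
    positivity
  · ext1 y
    have := pow_pos (norm_pos_iff.2 (hF'.lift y).ne_zero) 2
    -- The factor `e^{-h} = c‖F'‖²` cancels the `‖F'‖⁻²` in `π^*Ω`.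
    rw [ddc_const_mul_norm_sq hF'.holomorphic hc, kahlerForm, hF'.pullback_eq_ddc hF, ← hpot,
      smul_smul, mul_assoc, mul_inv_cancel₀ this.ne', mul_one]
  · intro γ y
    rw [hχ]
    ring
  · intro hinj
    rw [funext hpot]
    exact isProperPotential_exp_neg_pot hpot hκ
      (Function.Injective.of_comp (f := hopfCharacter l) hinj)
  · intro γ y h
    have : κ γ = 1 := hopfCharacter_injective (by simpa using h)
    rw [hκ, this]
    simp

end Conclusions

end KahlerCovering

/-! ### Manifold structures pulled back along local homeomorphisms -/

section LocalHomeomorph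

variable {E : Type*} [NormedAddCommGroup E] [NormedSpace ℂ E]
  {M : Type*} [TopologicalSpace M] [ChartedSpace E M] {N : Type*} [TopologicalSpace N]

/-- The charts of the source of a local homeomorphism `f` to a charted space: the local inverses of
the local sections of `f`, composed with the charts of the target. -/
@[reducible] def IsLocalHomeomorph.chartedSpacePullback {f : N → M} (hf : IsLocalHomeomorph f) :
    ChartedSpace E N where
  atlas := {c | ∃ (φ : OpenPartialHomeomorph N M) (e : OpenPartialHomeomorph M E),
    Set.EqOn f φ φ.source ∧ e ∈ atlas E M ∧ c = φ.trans e}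
  chartAt y := (hf y).choose.trans (chartAt E (f y))
  mem_chart_source y := by
    have h := (hf y).choose_spec
    have h2 : f y = (hf y).choose y := congrFun h.2 y
    rw [OpenPartialHomeomorph.trans_source]
    refine ⟨h.1, ?_⟩
    rw [Set.mem_preimage, ← h2]
    exact mem_chart_source E (f y)
  chart_mem_atlas y := by
    have h := (hf y).choose_spec
    exact ⟨(hf y).choose, chartAt E (f y), fun x _ => congrFun h.2 x, chart_mem_atlas E _, rfl⟩

/-- Both `φ` and `φ'` are restrictions of `f`, so they cancel in a change of charts, which is
therefore a restriction of one of `M`. -/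
theorem IsLocalHomeomorph.isManifold_pullback [IsManifold 𝓘(ℂ, E) ω M] {f : N → M}
    (hf : IsLocalHomeomorph f) :
    letI : ChartedSpace E N := hf.chartedSpacePullback
    IsManifold 𝓘(ℂ, E) ω N := by
  let _ : ChartedSpace E N := hf.chartedSpacePullback
  refine isManifold_of_contDiffOn 𝓘(ℂ, E) ω N ?_
  rintro _ _ ⟨φ, e, hφ, he, rfl⟩ ⟨φ', e', hφ', he', rfl⟩
  simp only [modelWithCornersSelf_coe, modelWithCornersSelf_coe_symm, Set.range_id,
    Set.preimage_id, Set.inter_univ, Function.id_comp, Function.comp_id]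
  have h1 : ContDiffOn ℂ ω (e.symm.trans e') (e.symm.trans e').source :=
    contMDiffOn_iff_contDiffOn.1 (contMDiffOn_of_mem_contDiffGroupoid
      (HasGroupoid.compatible (G := contDiffGroupoid ω 𝓘(ℂ, E)) he he'))
  have key : ∀ q ∈ ((φ.trans e).symm.trans (φ'.trans e')).source,
      φ' (φ.symm (e.symm q)) = e.symm q := by
    intro q hq
    simp only [OpenPartialHomeomorph.trans_source,
      OpenPartialHomeomorph.trans_symm_eq_symm_trans_symm, OpenPartialHomeomorph.coe_trans, Set.mem_inter_iff, Set.mem_preimage,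
      OpenPartialHomeomorph.symm_source, Function.comp_apply] at hq
    rw [← hφ' hq.2.1, hφ (φ.map_target hq.1.2), φ.right_inv hq.1.2]
  refine (h1.mono fun q hq => ?_).congr fun q hq => ?_
  · have hk := key q hq
    simp only [OpenPartialHomeomorph.trans_source,
      OpenPartialHomeomorph.trans_symm_eq_symm_trans_symm, OpenPartialHomeomorph.coe_trans, Set.mem_inter_iff, Set.mem_preimage,
      OpenPartialHomeomorph.symm_source, Function.comp_apply] at hq ⊢
    rw [hk] at hq
    exact ⟨hq.1.1, hq.2.2⟩
  · change e' (φ' (φ.symm (e.symm q))) = e' (e.symm q)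
    rw [key q hq]

theorem IsLocalHomeomorph.isLocalDiffeomorph_pullback [IsManifold 𝓘(ℂ, E) ω M] {f : N → M}
    (hf : IsLocalHomeomorph f) :
    letI : ChartedSpace E N := hf.chartedSpacePullback
    IsLocalDiffeomorph 𝓘(ℂ, E) 𝓘(ℂ, E) ω f := by
  let _ : ChartedSpace E N := hf.chartedSpacePullback
  have : IsManifold 𝓘(ℂ, E) ω N := hf.isManifold_pullback
  intro y
  obtain ⟨φ, hy, hfφ⟩ := hf y
  have hmem : ∀ x, φ.trans (chartAt E x) ∈ IsManifold.maximalAtlas 𝓘(ℂ, E) ω N := fun x =>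
    IsManifold.subset_maximalAtlas
      ⟨φ, chartAt E x, fun z _ => congrFun hfφ z, chart_mem_atlas E x, rfl⟩
  refine ⟨⟨φ.toPartialEquiv, φ.open_source, φ.open_target, fun z hz => ?_, fun x hx => ?_⟩, hy,
    fun z _ => congrFun hfφ z⟩
  · refine ContMDiffAt.contMDiffWithinAt ?_
    have hs : z ∈ (φ.trans (chartAt E (φ z))).source := by
      rw [OpenPartialHomeomorph.trans_source]
      exact ⟨hz, mem_chart_source E (φ z)⟩
    have h1 := contMDiffAt_of_mem_maximalAtlas (hmem (φ z)) hs
    have h2 : ContMDiffAt 𝓘(ℂ, E) 𝓘(ℂ, E) ω (chartAt E (φ z)).symm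
        ((φ.trans (chartAt E (φ z))) z) :=
      contMDiffOn_chart_symm.contMDiffAt
        ((chartAt E (φ z)).open_target.mem_nhds (mem_chart_target E (φ z)))
    refine (h2.comp z h1).congr_of_eventuallyEq ?_
    filter_upwards [(φ.trans (chartAt E (φ z))).open_source.mem_nhds hs] with w hw
    rw [OpenPartialHomeomorph.trans_source] at hw
    exact ((chartAt E (φ z)).left_inv hw.2).symm
  · refine ContMDiffAt.contMDiffWithinAt ?_
    have ht : chartAt E x x ∈ (φ.trans (chartAt E x)).target := by
      rw [OpenPartialHomeomorph.trans_target]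
      refine ⟨mem_chart_target E x, ?_⟩
      rw [Set.mem_preimage, (chartAt E x).left_inv (mem_chart_source E x)]
      exact hx
    have h1 := contMDiffAt_symm_of_mem_maximalAtlas (hmem x) ht
    have h2 : ContMDiffAt 𝓘(ℂ, E) 𝓘(ℂ, E) ω (chartAt E x) x :=
      contMDiffOn_chart.contMDiffAt ((chartAt E x).open_source.mem_nhds (mem_chart_source E x))
    refine (h1.comp x h2).congr_of_eventuallyEq ?_
    filter_upwards [(chartAt E x).open_source.mem_nhds (mem_chart_source E x)] with w hw
    change φ.symm w = φ.symm ((chartAt E x).symm (chartAt E x w))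
    rw [(chartAt E x).left_inv hw]

end LocalHomeomorph

/-! ### The pullback of the covering `V \ {0} → (V \ {0}) / ⟨l • id⟩` -/

section HopfPullback

variable {V : Type*} [NormedAddCommGroup V] [InnerProductSpace ℂ V] {l : HopfParameter}
  {M : Type*}

/-- The pullback of the covering `V \ {0} → (V \ {0}) / ⟨l • id⟩` along a map `F`. -/
def HopfPullback (F : M → HopfManifold V l) : Type _ := {p : M × V // IsHopfLift p.2 (F p.1)}

namespace HopfPullback

variable {F : M → HopfManifold V l}

/-- The projection to the base. -/
def base (p : HopfPullback F) : M := p.1.1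

/-- The projection to `V`. -/
def vec (p : HopfPullback F) : V := p.1.2

theorem isHopfLift_vec (p : HopfPullback F) : IsHopfLift p.vec (F p.base) := p.2

@[ext] theorem ext {p q : HopfPullback F} (h1 : p.base = q.base) (h2 : p.vec = q.vec) : p = q :=
  Subtype.ext (Prod.ext h1 h2)

/-- The multiplication by a power of `l`. -/
def shift (k : ℤ) (p : HopfPullback F) : HopfPullback F :=
  ⟨(p.base, l.val ^ k • p.vec), p.isHopfLift_vec.zpow_smul k⟩

theorem vec_shift (k : ℤ) (p : HopfPullback F) : (p.shift k).vec = l.val ^ k • p.vec := rfl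

theorem shift_zero (p : HopfPullback F) : p.shift 0 = p := by
  ext
  · rfl
  · simp [vec_shift]

theorem shift_add (k m : ℤ) (p : HopfPullback F) : p.shift (k + m) = (p.shift m).shift k := by
  ext
  · rfl
  · simp [vec_shift, smul_smul, zpow_add₀ l.ne_zero]

theorem shift_neg_shift (k : ℤ) (p : HopfPullback F) : (p.shift k).shift (-k) = p := by
  rw [← shift_add, neg_add_cancel, shift_zero]

theorem exists_shift_eq {p q : HopfPullback F} (h : p.base = q.base) : ∃ k : ℤ, q = p.shift k := by
  have hq := q.isHopfLift_vec
  rw [← h] at hq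
  obtain ⟨k, hk⟩ := p.isHopfLift_vec.exists_zpow hq
  exact ⟨k, ext h.symm hk⟩

theorem eq_zero_of_shift_eq {p : HopfPullback F} {k : ℤ} (h : p.shift k = p) : k = 0 := by
  refine p.isHopfLift_vec.zpow_unique (k := k) (m := 0) ?_
  rw [← vec_shift, ← vec_shift, h, shift_zero]

variable [TopologicalSpace M]

instance : TopologicalSpace (HopfPullback F) :=
  inferInstanceAs (TopologicalSpace {p : M × V // IsHopfLift p.2 (F p.1)})

instance [T2Space M] : T2Space (HopfPullback F) :=
  inferInstanceAs (T2Space {p : M × V // IsHopfLift p.2 (F p.1)})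

theorem continuous_base : Continuous (base : HopfPullback F → M) :=
  continuous_fst.comp continuous_subtype_val

theorem continuous_vec : Continuous (vec : HopfPullback F → V) :=
  continuous_snd.comp continuous_subtype_val

theorem continuous_shift (k : ℤ) : Continuous (shift k : HopfPullback F → HopfPullback F) :=
  Continuous.subtype_mk (continuous_base.prodMk (continuous_vec.const_smul _)) _

/-- A continuous local section passes through each point of the pullback. -/
theorem isOpenMap_base (hF : Continuous F) : IsOpenMap (base : HopfPullback F → M) := by
  rw [isOpenMap_iff_nhds_le]
  intro p
  obtain ⟨g, hg, hgl, hgp⟩ := exists_local_lift (G := F) hF.continuousAt p.isHopfLift_vec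
  classical
  -- The value `p` where `g` fails to be a lift is irrelevant: only the germ at `p.base` is used.
  let σ : M → HopfPullback F := fun x =>
    if h : IsHopfLift (g x) (F x) then ⟨(x, g x), h⟩ else p
  have hσ_eq : ∀ {x} (hx : IsHopfLift (g x) (F x)), σ x = ⟨(x, g x), hx⟩ := fun hx => dif_pos hx
  have hσ : Filter.Tendsto σ (𝓝 p.base) (𝓝 p) := by
    have hind : Topology.IsInducing (Subtype.val : HopfPullback F → M × V) :=
      Topology.IsInducing.subtypeVal
    refine hind.tendsto_nhds_iff.2 ?_
    have h1 : Filter.Tendsto (fun x => (x, g x)) (𝓝 p.base) (𝓝 (p.base, g p.base)) :=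
      Filter.tendsto_id.prodMk_nhds hg
    rw [hgp] at h1
    refine h1.congr' ?_
    filter_upwards [hgl] with x hx
    exact (congrArg Subtype.val (hσ_eq hx)).symm
  have hbσ : (base ∘ σ) =ᶠ[𝓝 p.base] id := by
    filter_upwards [hgl] with x hx
    rw [Function.comp_apply, hσ_eq hx]
    rfl
  calc 𝓝 p.base = Filter.map (base ∘ σ) (𝓝 p.base) := by
        rw [Filter.map_congr hbσ, Filter.map_id]
    _ = Filter.map base (Filter.map σ (𝓝 p.base)) := Filter.map_map.symm
    _ ≤ Filter.map base (𝓝 p) := Filter.map_mono hσ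

/-- Near `p` the vector is `l ^ k • g` of the base point with a single exponent `k`, so the base
point determines it. -/
theorem exists_isOpen_injOn_base (hF : Continuous F) (p : HopfPullback F) :
    ∃ U : Set (HopfPullback F), IsOpen U ∧ p ∈ U ∧ Set.InjOn base U := by
  obtain ⟨g, hg, hgl, hgp⟩ := exists_local_lift (G := F) hF.continuousAt p.isHopfLift_vec
  obtain ⟨k, hk⟩ := eventually_eq_zpow_smul (f := fun q : HopfPullback F => F q.base)
    (ContinuousAt.comp (g := g) hg continuous_base.continuousAt) continuous_vec.continuousAt
    (continuous_base.continuousAt.eventually hgl) (Filter.Eventually.of_forall isHopfLift_vec)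
  obtain ⟨U, hU, hUo, hpU⟩ := eventually_nhds_iff.1 hk
  refine ⟨U, hUo, hpU, fun q hq q' hq' h => ext h ?_⟩
  rw [hU q hq, hU q' hq']
  simp only [Function.comp_apply, h]

theorem isLocalHomeomorph_base (hF : Continuous F) :
    IsLocalHomeomorph (base : HopfPullback F → M) := by
  rw [isLocalHomeomorph_iff_isOpenEmbedding_restrict]
  intro p
  obtain ⟨U, hUo, hpU, hinj⟩ := exists_isOpen_injOn_base hF p
  refine ⟨U, hUo.mem_nhds hpU, Topology.IsOpenEmbedding.of_continuous_injective_isOpenMap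
    (continuous_base.comp continuous_subtype_val) (Set.injOn_iff_injective.1 hinj)
    ((isOpenMap_base hF).comp hUo.isOpenMap_subtype_val)⟩

theorem shift_mem_connectedComponent_iff {p q : HopfPullback F} (k : ℤ) :
    q.shift k ∈ connectedComponent (p.shift k) ↔ q ∈ connectedComponent p := by
  refine ⟨fun h => ?_, fun h => (continuous_shift k).mapsTo_connectedComponent p h⟩
  have := (continuous_shift (-k)).mapsTo_connectedComponent (p.shift k) h
  rwa [shift_neg_shift, shift_neg_shift] at this

/-- The connected component of a point of the pullback. -/
abbrev Component (p : HopfPullback F) : Type _ := {q : HopfPullback F // q ∈ connectedComponent p}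

/-- The powers of `l` which preserve the connected component. -/
def componentGroup (p : HopfPullback F) : Subgroup (Multiplicative ℤ) where
  carrier := {k | ∀ q, q.shift k.toAdd ∈ connectedComponent p ↔ q ∈ connectedComponent p}
  one_mem' q := by rw [toAdd_one, shift_zero]
  mul_mem' {a b} ha hb q := by rw [toAdd_mul, shift_add, ha, hb]
  inv_mem' {a} ha q := by
    rw [← ha, ← shift_add, toAdd_inv, add_neg_cancel, shift_zero]

instance (p : HopfPullback F) : MulAction (componentGroup p) (Component p) where
  smul k q := ⟨q.1.shift k.1.toAdd, (k.2 q.1).2 q.2⟩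
  one_smul q := Subtype.ext (shift_zero q.1)
  mul_smul a b q := Subtype.ext (shift_add a.1.toAdd b.1.toAdd q.1)

/-- Shifts permute the connected components, so a shift keeping one point in a component preserves
the whole component. -/
theorem mem_componentGroup {p q : HopfPullback F} {k : ℤ} (hq : q ∈ connectedComponent p)
    (hk : q.shift k ∈ connectedComponent p) : Multiplicative.ofAdd k ∈ componentGroup p := by
  intro r
  rw [toAdd_ofAdd]
  have h1 : connectedComponent p = connectedComponent q := connectedComponent_eq hq
  have h2 : connectedComponent p = connectedComponent (q.shift k) := connectedComponent_eq hk
  nth_rewrite 1 [h2]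
  rw [shift_mem_connectedComponent_iff, h1]

theorem surjective_component_base [LocallyConnectedSpace (HopfPullback F)] [ConnectedSpace M]
    (hF : Continuous F) (p : HopfPullback F) :
    Function.Surjective fun q : Component p => q.1.base := by
  have hopen : ∀ q : HopfPullback F, IsOpen (base '' connectedComponent q) := fun q =>
    isOpenMap_base hF _ isOpen_connectedComponent
  -- The images of two components are equal or disjoint: points of both in one fibre differ by a
  -- shift, which carries one component onto the other.
  have hclopen : IsClopen (base '' connectedComponent p) := by
    refine ⟨⟨isOpen_iff_mem_nhds.2 fun x hx => ?_⟩, hopen p⟩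
    obtain ⟨z, hz⟩ := exists_isHopfLift (F x)
    let q : HopfPullback F := ⟨(x, z), hz⟩
    refine Filter.mem_of_superset ((hopen q).mem_nhds ⟨q, mem_connectedComponent, rfl⟩) ?_
    rintro _ ⟨q', hq', rfl⟩ ⟨p', hp', hpq⟩
    obtain ⟨k, rfl⟩ := exists_shift_eq hpq.symm
    refine hx ⟨q.shift k, ?_, rfl⟩
    rw [connectedComponent_eq hp', shift_mem_connectedComponent_iff, ← connectedComponent_eq hq']
    exact mem_connectedComponent
  have huniv := hclopen.eq_univ ⟨_, p, mem_connectedComponent, rfl⟩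
  intro x
  obtain ⟨q, hq, hqx⟩ : x ∈ base '' connectedComponent p := by rw [huniv]; trivial
  exact ⟨⟨q, hq⟩, hqx⟩

theorem isLocalHomeomorph_component_base [LocallyConnectedSpace (HopfPullback F)]
    (hF : Continuous F) (p : HopfPullback F) :
    IsLocalHomeomorph fun q : Component p => q.1.base :=
  (isLocalHomeomorph_base hF).comp
    (isOpen_connectedComponent.isOpenEmbedding_subtypeVal).isLocalHomeomorph

theorem isQuotientCoveringMap_component_base [LocallyConnectedSpace (HopfPullback F)]
    [ConnectedSpace M] (hF : Continuous F) (p : HopfPullback F) :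
    IsQuotientCoveringMap (fun q : Component p => q.1.base) (componentGroup p) where
  toIsQuotientMap := (isLocalHomeomorph_component_base hF p).isOpenMap.isQuotientMap
    (isLocalHomeomorph_component_base hF p).continuous (surjective_component_base hF p)
  continuous_const_smul k :=
    ((continuous_shift k.1.toAdd).comp continuous_subtype_val).subtype_mk _
  apply_eq_iff_mem_orbit {q q'} := by
    constructor
    · intro h
      obtain ⟨k, hk⟩ := exists_shift_eq (p := q'.1) (q := q.1) h.symm
      refine ⟨⟨Multiplicative.ofAdd k, mem_componentGroup q'.2 ?_⟩, Subtype.ext hk.symm⟩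
      rw [← hk]
      exact q.2
    · rintro ⟨k, rfl⟩
      rfl
  -- A shift preserves the base point, so inside a set where `base` is injective it would fix a
  -- point, which forces exponent 0.
  disjoint q := by
    obtain ⟨U, hUo, hqU, hinj⟩ := exists_isOpen_injOn_base hF q.1
    refine ⟨Subtype.val ⁻¹' U, (hUo.preimage continuous_subtype_val).mem_nhds hqU, ?_⟩
    rintro k ⟨_, ⟨r, hr, rfl⟩, hr'⟩
    have h1 : r.1.shift k.1.toAdd = r.1 := hinj hr' hr rfl
    exact Subtype.ext (eq_zero_of_shift_eq h1)

end HopfPullback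

end HopfPullback

/-! ### The minimal Kähler covering -/

section Minimal

variable {V : Type w} [NormedAddCommGroup V] [InnerProductSpace ℂ V] {l : HopfParameter}
  {E : Type v} [NormedAddCommGroup E] [NormedSpace ℂ E] {M : Type u} [TopologicalSpace M]
  [ChartedSpace E M]

/-- The whole pullback may be disconnected, hence the passage to a component. It is a quotient
covering for the shifts preserving it, which gives the Galois property, and `-log‖vec‖²` is a
primitive of the pulled back Lee form. The final joint injectivity is what yields minimality. -/
theorem exists_minimal_kahlerCovering [FiniteDimensional ℂ E] (hdim : 2 ≤ Module.finrank ℂ E)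
    [IsManifold 𝓘(ℂ, E) ω M] [T2Space M] [ConnectedSpace M] {Ω : DiffForm E M 2}
    {θ : DiffForm E M 1} (hΩ : IsLCK Ω θ) {F : M → HopfManifold V l} (hF : IsLCKImmersion Ω F) :
    ∃ (K : KahlerCovering.{max u w} θ) (F' : K.carrier → V), K.IsHolomorphicLift F F' ∧
      (∀ y, ‖F' y‖ ^ 2 = Real.exp (-K.pot y)) ∧
      ∀ y y', K.proj y = K.proj y' → F' y = F' y' → y = y' := by
  have hFc := hF.holomorphic.continuous
  obtain ⟨x₀⟩ : Nonempty M := inferInstance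
  obtain ⟨z₀, hz₀⟩ := exists_isHopfLift (F x₀)
  let p : HopfPullback F := ⟨(x₀, z₀), hz₀⟩
  have hloc : LocallyConnectedSpace (HopfPullback F) := by
    let _ : ChartedSpace E (HopfPullback F) :=
      (HopfPullback.isLocalHomeomorph_base hFc).chartedSpacePullback
    exact ChartedSpace.locallyConnectedSpace E (HopfPullback F)
  have hlh := HopfPullback.isLocalHomeomorph_component_base hFc p
  have hq := HopfPullback.isQuotientCoveringMap_component_base hFc p
  have : ConnectedSpace (HopfPullback.Component p) :=
    isConnected_iff_connectedSpace.1 isConnected_connectedComponent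
  let _ : ChartedSpace E (HopfPullback.Component p) := hlh.chartedSpacePullback
  have : IsManifold 𝓘(ℂ, E) ω (HopfPullback.Component p) := hlh.isManifold_pullback
  have hld : IsLocalDiffeomorph 𝓘(ℂ, E) 𝓘(ℂ, E) ω
      fun q : HopfPullback.Component p => q.1.base := hlh.isLocalDiffeomorph_pullback
  have hvc : Continuous fun q : HopfPullback.Component p => q.1.vec :=
    HopfPullback.continuous_vec.comp continuous_subtype_val
  have hvl : ∀ q : HopfPullback.Component p, IsHopfLift q.1.vec (F q.1.base) :=
    fun q => q.1.isHopfLift_vec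
  have hv : ContMDiff 𝓘(ℂ, E) 𝓘(ℂ, V) ω fun q : HopfPullback.Component p => q.1.vec := fun q =>
    contMDiffAt_of_isHopfLift (hF.holomorphic.comp hld.contMDiff q) hvc.continuousAt
      (Filter.Eventually.of_forall hvl)
  have hcs := hq.toContinuousConstSMul
  let K : KahlerCovering.{max u w} θ :=
    { carrier := HopfPullback.Component p
      proj := fun q => q.1.base
      covering := hq.isCoveringMap
      surjective := hq.surjective
      localDiffeo := hld
      galois := fun y y' h => by
        obtain ⟨k, hk⟩ := hq.apply_eq_iff_mem_orbit.1 h.symm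
        exact ⟨Homeomorph.smul k, fun y => rfl, hk⟩
      pot := fun q => -Real.log (‖q.1.vec‖ ^ 2)
      smooth_pot := fun q => contMDiffAt_neg_log_norm_sq (hv q) (hvl q).ne_zero
      d_pot := funext fun q => pullback_lee_eq_differential hdim hΩ hF (hld.contMDiff q)
        hvc.continuousAt (Filter.Eventually.of_forall hvl) }
  refine ⟨K, fun q => q.1.vec, ⟨hv, hvl⟩, fun q => ?_, fun y y' h1 h2 =>
    Subtype.ext (HopfPullback.ext h1 h2)⟩
  change _ = Real.exp (- -Real.log (‖q.1.vec‖ ^ 2))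
  rw [neg_neg, Real.exp_log (pow_pos (norm_pos_iff.2 (hvl q).ne_zero) 2)]

end Minimal

theorem mainTheorem5 {E : Type v} [NormedAddCommGroup E] [NormedSpace ℂ E]
    [FiniteDimensional ℂ E] (hdim : 2 ≤ Module.finrank ℂ E)
    {M : Type u} [TopologicalSpace M] [ChartedSpace E M] [IsManifold 𝓘(ℂ, E) ω M]
    [CompactSpace M] [T2Space M] [ConnectedSpace M]
    (Ω : DiffForm E M 2) (θ : DiffForm E M 1) (hΩ : IsLCK Ω θ)
    (l : HopfParameter) (F : M → HopfManifold (lp (fun _ : ℕ => ℂ) 2) l)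
    (hF : IsLCKImmersion Ω F) :
    (∃ (K : KahlerCovering.{u} θ) (χ : K.Deck →* {r : ℝ // 0 < r})
        (F' : K.carrier → lp (fun _ : ℕ => ℂ) 2),
      K.IsHomothetyCharacter Ω χ ∧ Function.Injective χ ∧
      χ.range ≤ (hopfCharacter l).range ∧ KahlerCovering.lckRank χ = 1 ∧
      K.IsHolomorphicLift F F' ∧
      K.IsAutomorphicPotential Ω χ (fun y => ‖F' y‖ ^ 2) ∧
      K.IsProperPotential (fun y => ‖F' y‖ ^ 2)) ∧
    (∀ K : KahlerCovering.{w} θ,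
      ∃ χ : K.Deck →* {r : ℝ // 0 < r}, K.IsHomothetyCharacter Ω χ ∧
        χ.range ≤ (hopfCharacter l).range ∧
        KahlerCovering.lckRank χ = 1 ∧
        ∃ (F' : K.carrier → lp (fun _ : ℕ => ℂ) 2) (c : ℝ), 0 < c ∧
          K.IsHolomorphicLift F F' ∧
          (∀ y, Ω.pullback K.proj y = (‖F' y‖ ^ 2)⁻¹ • ddc E (fun z => ‖F' z‖ ^ 2) y) ∧
          K.IsAutomorphicPotential Ω χ (fun y => c * ‖F' y‖ ^ 2) ∧
          (Function.Injective χ → K.IsProperPotential (fun y => c * ‖F' y‖ ^ 2))) := by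
  have : Nontrivial E := Module.nontrivial_of_finrank_pos (R := ℂ) (by omega)
  constructor
  · obtain ⟨K, F', hF', hpot, hinj⟩ := exists_minimal_kahlerCovering hdim hΩ hF
    obtain ⟨χ, h1, h2, h3, h4, h5, h6⟩ :=
      hF'.exists_character hΩ hF one_pos (by simpa using hpot)
    -- A deck transformation with trivial character fixes both `F'` and the projection, and together
    -- these determine the point.
    have hχ : Function.Injective χ := by
      rw [injective_iff_map_eq_one]
      intro γ hγ
      exact Subtype.ext (Homeomorph.ext fun y => hinj _ _ (γ.2 y) (h6 γ y hγ))
    simp only [one_mul] at h4 h5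
    exact ⟨K, χ, F', h1, hχ, h2, h3, hF', h4, h5 hχ⟩
  · intro K
    obtain ⟨F', c, hF', hc, hpot⟩ := K.exists_isHolomorphicLift hdim hΩ hF
    obtain ⟨χ, h1, h2, h3, h4, h5, -⟩ := hF'.exists_character hΩ hF hc hpot
    exact ⟨χ, h1, h2, h3, F', c, hc, hF', hF'.pullback_eq_ddc hF, h4, h5⟩

end
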